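/- Let $g\in\mathbb{C}^J$, $g\neq 0$, be a fixed channel, $h=g/\|g\|$, $\sigma>0$, $N\ge 1$, and let $r(i)=b(i)\,g+n(i)$, $i=1,\dots,N$, where the symbols $b(i)$ are uniform on $\{\pm1\}$, the noise vectors $n(i)$ are circularly symmetric complex Gaussian $\mathcal{CN}(0,\sigma^2 I)$, and all of these are independent. Let $\hat u$ be a random unit-norm eigenvector for the largest eigenvalue of the sample covariance $\hat R=\frac1N\sum_{i=1}^N r(i)r(i)^H$, let $\theta_o\in(0,2\pi]$ minimize $\theta\mapsto\|e^{\jmath\theta}\hat u-h\|^2$ (optimal phase correction), and decompose the error as $$\delta h_o=e^{\jmath\theta_o}\hat u-h=q_o+\alpha_o h,\qquad q_o\perp h .$$ Put $$F=\frac{(\sigma^2\|g\|^2+\sigma^4)(J-1)}{N\|g\|^4}.$$ Then $|\alpha_o|^2\ll\|q_o\|^2$ and, to first order, $\mathbb{E}\|\delta h_o\|^2\simeq\mathbb{E}\|q_o\|^2\simeq F$. Precisely: for every $J$ and every $\varepsilon>0$ there is $\eta>0$, depending only on $J$ and $\varepsilon$, such that for all $g,\sigma,N$ as above: (i) almost surely,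 if $\|q_o\|\le\eta$ then $|\alpha_o|^2\le\varepsilon\|q_o\|^2$; (ii) if $F\le\eta$, then $\mathbb{P}\big(|\alpha_o|^2>\varepsilon\|q_o\|^2\big)\le\varepsilon$ and $\mathbb{E}|\alpha_o|^2\le\varepsilon\,\mathbb{E}\|q_o\|^2$; (iii) if $F\le\eta$, then $$\big|\mathbb{E}\|\delta h_o\|^2-\mathbb{E}\|q_o\|^2\big|\le\varepsilon\,\mathbb{E}\|q_o\|^2,\qquad \big|\mathbb{E}\|q_o\|^2-F\big|\le\varepsilon F,\qquad \big|\mathbb{E}\|\delta h_o\|^2-F\big|\le\varepsilon F .$$ In particular the approximations become exact, in relative error, as $N\to\infty$ with $g,\sigma$ fixed, and as $\sigma\to0$ with $g,N$ fixed. -/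

import Mathlib

open MeasureTheory ProbabilityTheory

noncomputable section

namespace SIMO

/-- The vector space `ℂ^J` with its Euclidean norm and Hermitian inner product. -/
abbrev CVec (J : ℕ) : Type := EuclideanSpace ℂ (Fin J)

/-- The circularly symmetric complex Gaussian law `CN(0, v)` on `ℂ`: the real and imaginary
parts are independent real Gaussians with mean zero and variance `v / 2`. -/
def complexGaussian (v : ℝ) : Measure ℂ :=
  ((gaussianReal 0 (v / 2).toNNReal).prod (gaussianReal 0 (v / 2).toNNReal)).map
    (fun p : ℝ × ℝ => (⟨p.1, p.2⟩ : ℂ))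

/-- The law of complex additive white Gaussian noise on `ℂ^J` with covariance matrix `v I`:
the coordinates are independent with law `CN(0, v)`. -/
def awgn (J : ℕ) (v : ℝ) : Measure (CVec J) :=
  (Measure.pi (fun _ : Fin J => complexGaussian v)).map (WithLp.toLp 2)

/-- The law of a BPSK symbol: `1` and `-1` with probability one half each. -/
def bpsk : Measure ℝ :=
  (2⁻¹ : ENNReal) • Measure.dirac 1 + (2⁻¹ : ENNReal) • Measure.dirac (-1)

/-- The symbols `b 0, …, b (N-1)` are BPSK, the noise vectors `n 0, …, n (N-1)` are white complex
Gaussian with covariance `σ² I`, and all of these are mutually independent. -/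
structure IsTransmission {Ω : Type*} [MeasurableSpace Ω] (P : Measure Ω) {J N : ℕ} (σ : ℝ)
    (b : Fin N → Ω → ℝ) (n : Fin N → Ω → CVec J) : Prop where
  law_symbol : ∀ i, HasLaw (b i) bpsk P
  law_noise : ∀ i, HasLaw (n i) (awgn J (σ ^ 2)) P
  indep_symbol_noise : ∀ i, IndepFun (b i) (n i) P
  indep_samples : iIndepFun (fun i ω => (b i ω, n i ω)) P

/-- The received vector `r = b g + n`. -/
def received {J : ℕ} (g : CVec J) (b : ℝ) (n : CVec J) : CVec J := (b : ℂ) • g + n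

/-- The sample covariance matrix `(1/N) ∑ᵢ rᵢ rᵢᴴ`. -/
def sampleCov {J N : ℕ} (r : Fin N → CVec J) : Matrix (Fin J) (Fin J) ℂ :=
  (N : ℂ)⁻¹ • ∑ i, Matrix.of (fun k l => r i k * star (r i l))

/-- `u` is a unit-norm eigenvector of the Hermitian matrix `A` for its largest eigenvalue. -/
def IsTopEigenvector {J : ℕ} (A : Matrix (Fin J) (Fin J) ℂ) (u : CVec J) : Prop :=
  ‖u‖ = 1 ∧ ∃ lam : ℝ,
    Module.End.HasEigenvector (Matrix.toEuclideanLin A) (lam : ℂ) u ∧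
    ∀ μ : ℝ, Module.End.HasEigenvalue (Matrix.toEuclideanLin A) (μ : ℂ) → μ ≤ lam

/-- The normalized channel `h = g / ‖g‖`. -/
def direction {J : ℕ} (g : CVec J) : CVec J := ((‖g‖ : ℂ))⁻¹ • g

/-- The rotated vector `exp(j θ) u`. -/
def rotate {J : ℕ} (θ : ℝ) (u : CVec J) : CVec J := Complex.exp (θ * Complex.I) • u

/-- `θ` is an optimal phase shift: it minimizes `‖exp(j θ) u - h‖²` over `(0, 2π]`. -/
def IsOptimalPhase {J : ℕ} (h u : CVec J) (θ : ℝ) : Prop :=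
  IsMinOn (fun φ : ℝ => ‖rotate φ u - h‖ ^ 2) (Set.Ioc 0 (2 * Real.pi)) θ ∧
    θ ∈ Set.Ioc 0 (2 * Real.pi)

/-- The coefficient `α = hᴴ δ` of the component of `δ` along the unit vector `h`. -/
def alongCoeff {J : ℕ} (h δ : CVec J) : ℂ := inner ℂ h δ

/-- The component `q = δ - α h` of `δ` orthogonal to the unit vector `h`. -/
def orthPart {J : ℕ} (h δ : CVec J) : CVec J := δ - alongCoeff h δ • h

/-- The closed form `(σ² ‖g‖² + σ⁴) (J - 1) / (N ‖g‖⁴)`. -/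
def mseFormula {J : ℕ} (g : CVec J) (σ : ℝ) (N : ℕ) : ℝ :=
  (σ ^ 2 * ‖g‖ ^ 2 + σ ^ 4) * ((J : ℝ) - 1) / (N * ‖g‖ ^ 4)

end SIMO

end

/-! The sample covariance equals `‖g‖² (h hᴴ + E) + σ² I`, where `E` (`meanExcess`) averages N
independent centred matrices. Scaling and shifting preserve eigenvectors, so `û` is a leading
eigenvector of a perturbed rank-one projection. Write `P⊥` for the projection off `h`, `Q = ‖q_o‖²`,
`W = ‖P⊥ E h‖²`, and `S` for the sum of the moduli of the entries of `E`. Three facts carry the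
proof.

Perturbation: if `S ≤ 1/4` then `|Q - W| ≤ 16 S W` (`abs_sub_le_of_isTopEigenvector`). The optimal
phase makes `hᴴ e^{jθ} û` equal to `|hᴴ û| = √(1 - Q)`, so `|α_o| = 1 - √(1 - Q) ≤ Q`: the parallel
error is of second order, which already gives (i).

Moments: `W` has mean exactly `F`, since averaging divides the one-sample second moment by N and the
noise law is rotation invariant. For `J ≥ 2`, `𝔼 S⁴ ≤ C F²` with `C` depending on J only, because
Gaussian moments scale with the variance.

Truncation: where `S` is not small, `Q ≤ 1` and `W ≤ S²` are dominated by a multiple of `S⁴`, whose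
mean is of order `F²` and hence negligible against `F`. `mean_square_error_bounds` turns this into
all the estimates. For `J = 1` both `q_o` and `F` vanish. -/

namespace SIMO

/-! ### Eigenvector perturbation and optimal phase -/

section Deterministic

variable {J : ℕ}

lemma norm_direction {g : CVec J} (hg : g ≠ 0) : ‖direction g‖ = 1 := by
  have : ‖g‖ ≠ 0 := norm_ne_zero_iff.mpr hg
  simp [direction, norm_smul, this]

lemma norm_rotate (θ : ℝ) (u : CVec J) : ‖rotate θ u‖ = ‖u‖ := by
  simp [rotate, norm_smul, Complex.norm_exp_ofReal_mul_I]

lemma orthPart_add (h x y : CVec J) : orthPart h (x + y) = orthPart h x + orthPart h y := by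
  simp only [orthPart, alongCoeff, inner_add_right, add_smul]; abel

lemma orthPart_smul (h : CVec J) (a : ℂ) (x : CVec J) :
    orthPart h (a • x) = a • orthPart h x := by
  simp only [orthPart, alongCoeff, inner_smul_right, smul_sub, mul_smul]

lemma orthPart_self {h : CVec J} (hh : ‖h‖ = 1) : orthPart h h = 0 := by
  simp [orthPart, alongCoeff, inner_self_eq_norm_sq_to_K, hh]

lemma orthPart_sub (h x y : CVec J) : orthPart h (x - y) = orthPart h x - orthPart h y := by
  simp only [orthPart, alongCoeff, inner_sub_right, sub_smul]; abel

lemma norm_sq_eq_orthPart_add_alongCoeff {h : CVec J} (hh : ‖h‖ = 1) (x : CVec J) :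
    ‖x‖ ^ 2 = ‖orthPart h x‖ ^ 2 + ‖alongCoeff h x‖ ^ 2 := by
  have h0 : inner ℂ (orthPart h x) (alongCoeff h x • h) = 0 := by
    simp only [orthPart, alongCoeff, inner_smul_right, inner_sub_left, inner_smul_left,
      inner_self_eq_norm_sq_to_K, hh]
    simp
  have h1 : x = orthPart h x + alongCoeff h x • h := by simp [orthPart]
  have h2 := norm_add_sq_eq_norm_sq_add_norm_sq_of_inner_eq_zero _ _ h0
  rw [← h1, norm_smul, hh] at h2
  nlinarith

lemma norm_orthPart_le {h : CVec J} (hh : ‖h‖ = 1) (x : CVec J) : ‖orthPart h x‖ ≤ ‖x‖ := by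
  have := norm_sq_eq_orthPart_add_alongCoeff hh x
  exact le_of_sq_le_sq (by nlinarith [sq_nonneg ‖alongCoeff h x‖]) (norm_nonneg _)

/-- Scalar core of the perturbation bound: `w`, `p` are the sizes of the parts of the eigenvector
orthogonal to and along `h`, `c` is that of `P⊥ T h`, and `l` is the eigenvalue. The hypotheses give
`(1 - 2e) w ≤ p c ≤ (1 + 2e) w`; squaring costs `4 e w² ≤ 16 e c²` on the upper side. -/
lemma abs_sq_sub_sq_le {e w c p l : ℝ} (he0 : 0 ≤ e) (he : e ≤ 1 / 4) (hw : 0 ≤ w) (hc : 0 ≤ c)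
    (hp : 0 ≤ p) (hl1 : 1 - e ≤ l) (hl2 : l ≤ 1 + e) (hpw : 1 = w ^ 2 + p ^ 2) (hce : c ≤ e)
    (h1 : l * w ≤ p * c + e * w) (h2 : p * c ≤ l * w + e * w) :
    |w ^ 2 - c ^ 2| ≤ 16 * e * c ^ 2 := by
  have hp1 : p ≤ 1 := by nlinarith [sq_nonneg w]
  have hlw : (1 - e) * w ≤ l * w := by gcongr
  have hlw' : l * w ≤ (1 + e) * w := by gcongr
  have hpc : p * c ≤ 1 * c := by gcongr
  have hA : w - 2 * (e * w) ≤ c := by linarith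
  have hB : p * c ≤ (1 + 2 * e) * w := by linarith
  have hew : e * w ≤ 1 / 4 * w := by gcongr
  have hwc : w ≤ 2 * c := by linarith
  have hw2 : w ^ 2 ≤ 4 * c ^ 2 := by
    calc w ^ 2 ≤ (2 * c) ^ 2 := by gcongr
      _ = 4 * c ^ 2 := by ring
  have hC : c ^ 2 ≤ e ^ 2 := by gcongr
  have hA2 : (w - 2 * (e * w)) ^ 2 ≤ c ^ 2 := by
    have : 0 ≤ w - 2 * (e * w) := by linarith
    gcongr
  have hB2 : (p * c) ^ 2 ≤ ((1 + 2 * e) * w) ^ 2 := by gcongr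
  have hcn := sq_nonneg c
  have hewn : e * w ^ 2 ≤ e * (4 * c ^ 2) := by gcongr
  have heen : 0 ≤ e ^ 2 * w ^ 2 := by positivity
  have hee : e * (e * w ^ 2) ≤ 1 / 4 * (e * w ^ 2) := by gcongr
  rw [abs_le]
  constructor
  -- Replacing `p` by 1 loses only `w² c²`, and `w² ≤ 4c² ≤ 4e² ≤ e`.
  · have h5 : w ^ 2 * c ^ 2 ≤ e * c ^ 2 := by
      gcongr
      nlinarith
    have h6 : (p * c) ^ 2 = c ^ 2 - w ^ 2 * c ^ 2 := by
      rw [mul_pow, show p ^ 2 = 1 - w ^ 2 by linarith]; ring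
    have h7 : ((1 + 2 * e) * w) ^ 2 = w ^ 2 + 4 * (e * w ^ 2) + 4 * (e * (e * w ^ 2)) := by ring
    have h8 : 0 ≤ e * c ^ 2 := by positivity
    by_cases hlt : w ^ 2 ≤ c ^ 2
    · have h9 : e * w ^ 2 ≤ e * c ^ 2 := by gcongr
      linarith
    · linarith
  · have h7 : (w - 2 * (e * w)) ^ 2 = w ^ 2 - 4 * (e * w ^ 2) + 4 * (e ^ 2 * w ^ 2) := by ring
    linarith

/-- Perturbation of the leading eigenvector of the rank-one projection `h hᴴ`. -/
lemma abs_norm_sq_orthPart_eigenvector_sub_le {h u : CVec J} (hh : ‖h‖ = 1) (hu : ‖u‖ = 1)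
    (T : CVec J →ₗ[ℂ] CVec J) {e l : ℝ} (he0 : 0 ≤ e) (he : e ≤ 1 / 4)
    (hT : ∀ x, ‖T x‖ ≤ e * ‖x‖)
    (heig : alongCoeff h u • h + T u = (l : ℂ) • u)
    (hl : 1 + (inner ℂ h (T h)).re ≤ l) :
    |‖orthPart h u‖ ^ 2 - ‖orthPart h (T h)‖ ^ 2| ≤ 16 * e * ‖orthPart h (T h)‖ ^ 2 := by
  set p := alongCoeff h u with hp
  set w := orthPart h u with hw
  set c := orthPart h (T h) with hc
  have hpy : 1 = ‖w‖ ^ 2 + ‖p‖ ^ 2 := by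
    have := norm_sq_eq_orthPart_add_alongCoeff hh u
    rw [hu] at this; simpa using this
  have hdec : u = p • h + w := by simp [hw, orthPart, hp]
  -- Maximality of the eigenvalue enters only here, through the Rayleigh bound `hl`; it excludes the
  -- eigenvectors nearly orthogonal to `h`, whose eigenvalues are near 0.
  have hl1 : 1 - e ≤ l := by
    have h1 : |(inner ℂ h (T h)).re| ≤ ‖inner ℂ h (T h)‖ := Complex.abs_re_le_norm _
    have h2 : ‖inner ℂ h (T h)‖ ≤ ‖h‖ * ‖T h‖ := norm_inner_le_norm _ _
    have h3 := hT h
    rw [hh] at h2 h3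
    have h4 := neg_abs_le (inner ℂ h (T h)).re
    linarith
  have hl2 : l ≤ 1 + e := by
    have h1 : ‖(l : ℂ) • u‖ ≤ ‖p • h‖ + ‖T u‖ := heig ▸ norm_add_le _ _
    have h3 := hT u
    rw [norm_smul, norm_smul, hh, hu] at h1
    rw [hu] at h3
    have h4 : ‖p‖ ≤ 1 := by nlinarith [sq_nonneg ‖w‖, norm_nonneg p]
    have h5 : ‖(l : ℂ)‖ = |l| := by simp
    have := le_abs_self l
    rw [h5] at h1
    linarith
  -- Projecting the eigenvalue equation off `h` kills the rank-one term.
  have hkey : (l : ℂ) • w - p • c = orthPart h (T w) := by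
    have h1 := congrArg (orthPart h) heig
    rw [orthPart_add, orthPart_smul, orthPart_self hh, smul_zero, zero_add, orthPart_smul] at h1
    rw [← hw] at h1
    rw [← h1]
    conv_lhs => rw [hdec]
    rw [map_add, map_smul, orthPart_add, orthPart_smul]
    simp [hc]
  have hTw : ‖orthPart h (T w)‖ ≤ e * ‖w‖ := (norm_orthPart_le hh _).trans (hT w)
  have hlw : ‖(l : ℂ) • w‖ = l * ‖w‖ := by
    rw [norm_smul]; simp [abs_of_nonneg (show 0 ≤ l by linarith)]
  have hpc : ‖p • c‖ = ‖p‖ * ‖c‖ := norm_smul _ _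
  have h1 : l * ‖w‖ ≤ ‖p‖ * ‖c‖ + e * ‖w‖ := by
    rw [← hlw, ← hpc]
    have := norm_sub_norm_le ((l : ℂ) • w) (p • c)
    rw [hkey] at this
    linarith
  have h2 : ‖p‖ * ‖c‖ ≤ l * ‖w‖ + e * ‖w‖ := by
    rw [← hlw, ← hpc]
    have h3 := norm_sub_rev (p • c) ((l : ℂ) • w)
    have := norm_sub_norm_le (p • c) ((l : ℂ) • w)
    rw [h3, hkey] at this
    linarith
  have hce : ‖c‖ ≤ e := by
    have := (norm_orthPart_le hh (T h)).trans (hT h)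
    rwa [hh, mul_one] at this
  exact abs_sq_sub_sq_le he0 he (norm_nonneg _) (norm_nonneg _) (norm_nonneg _) hl1 hl2 hpy hce
    h1 h2

/-- In an orthonormal eigenbasis the quadratic form is a sum of eigenvalues weighted by squared
coordinates. Tested at `h`, it bounds the top eigenvalue from below. -/
lemma re_inner_le_of_isTopEigenvalue {A : Matrix (Fin J) (Fin J) ℂ} (hA : A.IsHermitian) {lam : ℝ}
    (hlam : ∀ μ : ℝ, Module.End.HasEigenvalue (Matrix.toEuclideanLin A) (μ : ℂ) → μ ≤ lam)
    (x : CVec J) : (inner ℂ x (Matrix.toEuclideanLin A x)).re ≤ lam * ‖x‖ ^ 2 := by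
  have hs : (Matrix.toEuclideanLin A).IsSymmetric := Matrix.isSymmetric_toEuclideanLin_iff.mpr hA
  have hn : Module.finrank ℂ (CVec J) = J := by simp
  have h1 := (hs.eigenvectorBasis hn).sum_inner_mul_inner x (Matrix.toEuclideanLin A x)
  have h2 := (hs.eigenvectorBasis hn).sum_sq_norm_inner_right x
  rw [← h1, Complex.re_sum, ← h2, Finset.mul_sum]
  refine Finset.sum_le_sum fun i _ => ?_
  have h3 : inner ℂ (hs.eigenvectorBasis hn i) (Matrix.toEuclideanLin A x)
      = (hs.eigenvalues hn i : ℂ) * inner ℂ (hs.eigenvectorBasis hn i) x := by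
    rw [← hs, hs.apply_eigenvectorBasis, inner_smul_left]
    simp
  have h4 : hs.eigenvalues hn i ≤ lam := hlam _ (hs.hasEigenvalue_eigenvalues hn i)
  have h5 : inner ℂ x (hs.eigenvectorBasis hn i) * inner ℂ (hs.eigenvectorBasis hn i) x
      = ((‖inner ℂ (hs.eigenvectorBasis hn i) x‖ ^ 2 : ℝ) : ℂ) := by
    rw [← inner_conj_symm, Complex.conj_mul']
    simp
  rw [h3, mul_left_comm, h5, ← Complex.ofReal_mul, Complex.ofReal_re]
  gcongr

/-- The squared distance is `2 - 2 Re (e^{jφ} hᴴ u)`, and `(0, 2π]` is a full period, so the minimum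
makes `e^{jθ} hᴴ u` real and nonnegative. -/
lemma alongCoeff_of_isOptimalPhase {h u : CVec J} (hh : ‖h‖ = 1) (hu : ‖u‖ = 1) {θ : ℝ}
    (hθ : IsOptimalPhase h u θ) :
    alongCoeff h (rotate θ u - h) = (‖alongCoeff h u‖ - 1 : ℝ) := by
  have hexp : ∀ φ : ℝ, ‖rotate φ u - h‖ ^ 2
      = 2 - 2 * (Complex.exp (φ * Complex.I) * inner ℂ h u).re := fun φ => by
    rw [@norm_sub_sq ℂ, norm_rotate, hh, hu, ← inner_conj_symm, rotate, inner_smul_right]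
    simp only [RCLike.re_to_complex, Complex.conj_re]
    ring
  obtain ⟨φ, hφ, hφ2⟩ : ∃ φ ∈ Set.Ioc 0 (2 * Real.pi),
      Complex.exp (φ * Complex.I) * inner ℂ h u = (‖inner ℂ h u‖ : ℂ) := by
    refine ⟨toIocMod Real.two_pi_pos 0 (-(inner ℂ h u).arg), ?_, ?_⟩
    · simpa using toIocMod_mem_Ioc Real.two_pi_pos 0 (-(inner ℂ h u).arg)
    · have : Complex.exp ((toIocMod Real.two_pi_pos 0 (-(inner ℂ h u).arg) : ℝ) * Complex.I)
          = Complex.exp (((-(inner ℂ h u).arg : ℝ) : ℂ) * Complex.I) := by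
        rw [toIocMod]
        rw [Complex.exp_eq_exp_iff_exists_int]
        refine ⟨-toIocDiv Real.two_pi_pos 0 (-(inner ℂ h u).arg), ?_⟩
        simp only [zsmul_eq_mul]
        push_cast
        ring
      rw [this]
      conv_lhs => rw [← Complex.norm_mul_exp_arg_mul_I (inner ℂ h u)]
      rw [mul_left_comm, ← Complex.exp_add]
      simp
  have hmin : ‖rotate θ u - h‖ ^ 2 ≤ ‖rotate φ u - h‖ ^ 2 := hθ.1 hφ
  rw [hexp, hexp, hφ2, Complex.ofReal_re] at hmin
  have hnorm : ‖Complex.exp (θ * Complex.I) * inner ℂ h u‖ = ‖inner ℂ h u‖ := by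
    rw [norm_mul, Complex.norm_exp_ofReal_mul_I, one_mul]
  have hz : Complex.exp (θ * Complex.I) * inner ℂ h u = (‖inner ℂ h u‖ : ℂ) := by
    have h1 : (Complex.exp (θ * Complex.I) * inner ℂ h u).re
        = ‖Complex.exp (θ * Complex.I) * inner ℂ h u‖ :=
      le_antisymm (Complex.re_le_norm _) (by rw [hnorm]; linarith)
    have h2 := Complex.eq_coe_norm_of_nonneg (Complex.re_eq_norm.mp h1)
    rw [hnorm] at h2
    exact h2
  rw [alongCoeff, inner_sub_right, rotate, inner_smul_right, hz, inner_self_eq_norm_sq_to_K, hh]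
  simp [alongCoeff]

lemma norm_orthPart_rotate_sub {h : CVec J} (hh : ‖h‖ = 1) (u : CVec J) (θ : ℝ) :
    ‖orthPart h (rotate θ u - h)‖ = ‖orthPart h u‖ := by
  rw [orthPart_sub, orthPart_self hh, sub_zero, rotate, orthPart_smul, norm_smul,
    Complex.norm_exp_ofReal_mul_I, one_mul]

/-- With `p = |hᴴ u| ≤ 1`, this is `1 - p ≤ 1 - p²`. -/
lemma norm_alongCoeff_le_of_isOptimalPhase {h u : CVec J} (hh : ‖h‖ = 1) (hu : ‖u‖ = 1) {θ : ℝ}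
    (hθ : IsOptimalPhase h u θ) :
    ‖alongCoeff h (rotate θ u - h)‖ ≤ ‖orthPart h (rotate θ u - h)‖ ^ 2 := by
  rw [alongCoeff_of_isOptimalPhase hh hu hθ, norm_orthPart_rotate_sub hh, Complex.norm_real,
    Real.norm_eq_abs]
  have := norm_sq_eq_orthPart_add_alongCoeff hh u
  rw [hu] at this
  have h0 := norm_nonneg (alongCoeff h u)
  have h1 : ‖alongCoeff h u‖ ≤ 1 := by nlinarith [sq_nonneg ‖orthPart h u‖]
  rw [abs_of_nonpos (by linarith)]
  nlinarith

/-- The sum of the entries is a crude bound for the operator norm, but its fourth moment is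
controlled entry by entry. -/
lemma norm_toEuclideanLin_le (A : Matrix (Fin J) (Fin J) ℂ) (x : CVec J) :
    ‖Matrix.toEuclideanLin A x‖ ≤ (∑ k, ∑ l, ‖A k l‖) * ‖x‖ := by
  have h1 : Matrix.toEuclideanLin A x
      = ∑ k, ∑ l, EuclideanSpace.single k (A k l * x l) := by
    ext m
    simp [Matrix.toLpLin_apply, Matrix.mulVec, dotProduct, Finset.sum_apply, Pi.single_apply]
  rw [h1, Finset.sum_mul]
  refine (norm_sum_le _ _).trans (Finset.sum_le_sum fun k _ => ?_)
  rw [Finset.sum_mul]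
  refine (norm_sum_le _ _).trans (Finset.sum_le_sum fun l _ => ?_)
  rw [PiLp.norm_single, norm_mul]
  gcongr
  exact PiLp.norm_apply_le x l

end Deterministic

/-! ### Moments of averages of independent centred variables -/

section Averages

variable {Ω : Type*} [MeasurableSpace Ω] {P : Measure Ω} [IsProbabilityMeasure P]

lemma integrable_pow_of_memLp_four {X : Ω → ℝ} (hX : MemLp X 4 P) {k : ℕ} (hk : k ≤ 4) :
    Integrable (fun ω => X ω ^ k) P := by
  have h1 : MemLp X k P := hX.mono_exponent (by exact_mod_cast hk)
  have h2 := h1.integrable_norm_pow'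
  rw [← integrable_norm_iff (by have := h1.aestronglyMeasurable; fun_prop)]
  simpa using h2

lemma integral_pow_mul_pow {X Y : Ω → ℝ} (hX : MemLp X 4 P) (hY : MemLp Y 4 P)
    (h : IndepFun X Y P) {j k : ℕ} (hj : j ≤ 4) (hk : k ≤ 4) :
    Integrable (fun ω => X ω ^ j * Y ω ^ k) P ∧
      ∫ ω, X ω ^ j * Y ω ^ k ∂P = (∫ ω, X ω ^ j ∂P) * ∫ ω, Y ω ^ k ∂P := by
  have hi : IndepFun (fun ω => X ω ^ j) (fun ω => Y ω ^ k) P :=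
    h.comp (φ := fun x : ℝ => x ^ j) (ψ := fun x : ℝ => x ^ k) (by fun_prop) (by fun_prop)
  have h1 := integrable_pow_of_memLp_four hX hj
  have h2 := integrable_pow_of_memLp_four hY hk
  exact ⟨hi.integrable_mul h1 h2,
    hi.integral_fun_mul_eq_mul_integral h1.aestronglyMeasurable h2.aestronglyMeasurable⟩

lemma sq_integral_sq_le {X : Ω → ℝ} (hX : MemLp X 4 P) :
    (∫ ω, X ω ^ 2 ∂P) ^ 2 ≤ ∫ ω, X ω ^ 4 ∂P := by
  set s := ∫ ω, X ω ^ 2 ∂P with hs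
  have h2 := integrable_pow_of_memLp_four hX (show 2 ≤ 4 by norm_num)
  have h4 := integrable_pow_of_memLp_four hX (show 4 ≤ 4 by norm_num)
  have h0 : 0 ≤ ∫ ω, (X ω ^ 2 - s) ^ 2 ∂P := integral_nonneg fun ω => sq_nonneg _
  have h5 : ∫ ω, (X ω ^ 2 - s) ^ 2 ∂P = ∫ ω, (X ω ^ 4 - 2 * s * X ω ^ 2 + s ^ 2) ∂P := by
    congr 1; ext ω; ring
  rw [h5, integral_add (h4.sub' (h2.const_mul _)) (integrable_const _),
    integral_sub h4 (h2.const_mul _), integral_const_mul, ← hs] at h0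
  simp only [integral_const, probReal_univ, one_smul] at h0
  nlinarith

/-- Adding one variable to a sum of `k`, the cross terms with a factor of degree 1 vanish. What is
left is at most `m + 6 k s² + 3 k² m`, and `s² ≤ m` bounds it by `3 (k + 1)² m`. Growth like `k²`
instead of `k⁴` is the point. -/
lemma integral_sum_pow_of_iIndepFun {ι : Type*} {X : ι → Ω → ℝ} (hX : ∀ i, MemLp (X i) 4 P)
    (hindep : iIndepFun X P) (h0 : ∀ i, ∫ ω, X i ω ∂P = 0) {s m : ℝ}
    (h2 : ∀ i, ∫ ω, X i ω ^ 2 ∂P = s) (h4 : ∀ i, ∫ ω, X i ω ^ 4 ∂P = m) (t : Finset ι) :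
    MemLp (fun ω => ∑ i ∈ t, X i ω) 4 P ∧ ∫ ω, ∑ i ∈ t, X i ω ∂P = 0 ∧
      ∫ ω, (∑ i ∈ t, X i ω) ^ 2 ∂P = t.card * s ∧
      ∫ ω, (∑ i ∈ t, X i ω) ^ 4 ∂P ≤ 3 * (t.card : ℝ) ^ 2 * m := by
  classical
  induction t using Finset.induction_on with
  | empty => simp
  | insert a t ha ih =>
    obtain ⟨hS, hS1, hS2, hS4⟩ := ih
    have hi : IndepFun (fun ω => ∑ i ∈ t, X i ω) (X a) P := by
      have := hindep.indepFun_finsetSum_of_notMem₀ (fun i => (hX i).aemeasurable) ha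
      convert this using 1
      ext ω; simp
    have hsm : s ^ 2 ≤ m := by
      rw [← h2 a, ← h4 a]; exact sq_integral_sq_le (hX a)
    have hm0 : 0 ≤ m := (sq_nonneg s).trans hsm
    set S := fun ω => ∑ i ∈ t, X i ω with hSdef
    simp only [Finset.sum_insert ha, Finset.card_insert_of_notMem ha]
    have e1 : ∀ ω, ∑ i ∈ t, X i ω = S ω := fun _ => rfl
    simp only [e1] at hS1 hS2 hS4 ⊢
    have hS1' := hS.integrable (by norm_num)
    have hX1' := (hX a).integrable (by norm_num)
    have hS1p : ∫ ω, S ω ^ 1 ∂P = 0 := by simpa only [pow_one] using hS1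
    have hX1p : ∫ ω, X a ω ^ 1 ∂P = 0 := by simpa only [pow_one] using h0 a
    have I := @integral_pow_mul_pow Ω _ P _ _ _ hS (hX a) hi
    refine ⟨(hX a).add hS, ?_, ?_, ?_⟩
    · rw [integral_add hX1' hS1', h0, hS1, add_zero]
    · have e2 : ∀ ω, (X a ω + S ω) ^ 2 = X a ω ^ 2 + 2 * (S ω ^ 1 * X a ω ^ 1) + S ω ^ 2 :=
        fun ω => by ring
      simp only [e2]
      obtain ⟨i11, j11⟩ := @I 1 1 (by norm_num) (by norm_num)
      rw [integral_add ((integrable_pow_of_memLp_four (hX a) (show 2 ≤ 4 by norm_num)).fun_add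
          (i11.const_mul _))
        (integrable_pow_of_memLp_four hS (show 2 ≤ 4 by norm_num)),
        integral_add (integrable_pow_of_memLp_four (hX a) (show 2 ≤ 4 by norm_num))
          (i11.const_mul _),
        integral_const_mul, j11, hS1p, hX1p, hS2, h2]
      push_cast; ring
    · have e2 : ∀ ω, (X a ω + S ω) ^ 4 = X a ω ^ 4 + 4 * (S ω ^ 1 * X a ω ^ 3)
          + 6 * (S ω ^ 2 * X a ω ^ 2) + 4 * (S ω ^ 3 * X a ω ^ 1) + S ω ^ 4 := fun ω => by ring
      simp only [e2]
      have iX := integrable_pow_of_memLp_four (hX a) (le_refl 4)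
      have iS := integrable_pow_of_memLp_four hS (le_refl 4)
      obtain ⟨i13, j13⟩ := @I 1 3 (by norm_num) (by norm_num)
      obtain ⟨i22, j22⟩ := @I 2 2 (by norm_num) (by norm_num)
      obtain ⟨i31, j31⟩ := @I 3 1 (by norm_num) (by norm_num)
      rw [integral_add (((iX.fun_add (i13.const_mul _)).fun_add (i22.const_mul _)).fun_add
          (i31.const_mul _)) iS,
        integral_add ((iX.fun_add (i13.const_mul _)).fun_add (i22.const_mul _)) (i31.const_mul _),
        integral_add (iX.fun_add (i13.const_mul _)) (i22.const_mul _),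
        integral_add iX (i13.const_mul _), integral_const_mul, integral_const_mul,
        integral_const_mul, j13, j22, j31, hS1p, hX1p, hS2, h2, h4]
      have : (t.card : ℝ) * s * s ≤ t.card * m := by
        rw [mul_assoc, ← sq]
        exact mul_le_mul_of_nonneg_left hsm (Nat.cast_nonneg _)
      push_cast
      nlinarith

/-- Second and fourth moments of the average of centred independent samples. -/
lemma integral_average_pow {N : ℕ} (hN : 0 < N) {𝓧 : Type*} [MeasurableSpace 𝓧] {μ : Measure 𝓧}
    {Y : Fin N → Ω → 𝓧} (hY : ∀ i, HasLaw (Y i) μ P) (hindep : iIndepFun Y P) {f : 𝓧 → ℝ}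
    (hf : Measurable f) (hf4 : MemLp f 4 μ) (hf0 : ∫ x, f x ∂μ = 0) :
    MemLp (fun ω => (N : ℝ)⁻¹ * ∑ i, f (Y i ω)) 4 P ∧
      ∫ ω, ((N : ℝ)⁻¹ * ∑ i, f (Y i ω)) ^ 2 ∂P = (N : ℝ)⁻¹ * ∫ x, f x ^ 2 ∂μ ∧
      ∫ ω, ((N : ℝ)⁻¹ * ∑ i, f (Y i ω)) ^ 4 ∂P ≤ 3 * ((N : ℝ)⁻¹) ^ 2 * ∫ x, f x ^ 4 ∂μ := by
  have hNr : (N : ℝ) ≠ 0 := by positivity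
  have hc : ∀ i, ∀ k : ℕ, ∫ ω, f (Y i ω) ^ k ∂P = ∫ x, f x ^ k ∂μ := fun i k =>
    (hY i).integral_comp (f := fun x => f x ^ k) (hf.pow_const k).aestronglyMeasurable
  have hX : ∀ i, MemLp (fun ω => f (Y i ω)) 4 P := fun i => by
    have h1 := (hY i).map_eq ▸ hf4
    exact (memLp_map_measure_iff hf.aestronglyMeasurable (hY i).aemeasurable).mp h1
  obtain ⟨h1, -, h2, h4⟩ := integral_sum_pow_of_iIndepFun hX (hindep.comp (fun _ => f) fun _ => hf)
    (fun i => by have := hc i 1; simpa [hf0] using this) (fun i => hc i 2) (fun i => hc i 4)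
    Finset.univ
  refine ⟨h1.const_mul _, ?_, ?_⟩
  · simp only [mul_pow]
    rw [integral_const_mul, h2]
    simp only [Finset.card_univ, Fintype.card_fin]
    field_simp
  · simp only [mul_pow]
    rw [integral_const_mul]
    refine (mul_le_mul_of_nonneg_left h4 (by positivity)).trans (le_of_eq ?_)
    simp only [Finset.card_univ, Fintype.card_fin]
    field_simp

lemma memLp_four_of_integrable_norm_pow {𝓧 : Type*} [MeasurableSpace 𝓧] {μ : Measure 𝓧}
    {f : 𝓧 → ℂ} (hf : AEStronglyMeasurable f μ) (h : Integrable (fun x => ‖f x‖ ^ 4) μ) :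
    MemLp f 4 μ := by
  rw [← integrable_norm_rpow_iff hf (by norm_num) (by norm_num)]
  convert h using 2 with x
  exact_mod_cast Real.rpow_natCast ‖f x‖ 4

/-- Real and imaginary parts are treated separately; `|z|⁴ ≤ 2 (A⁴ + B⁴)` turns the constant 3 into
`2 (3 + 3) = 12`. -/
lemma integral_average_norm_pow {N : ℕ} (hN : 0 < N) {𝓧 : Type*} [MeasurableSpace 𝓧]
    {μ : Measure 𝓧} [IsProbabilityMeasure μ] {Y : Fin N → Ω → 𝓧} (hY : ∀ i, HasLaw (Y i) μ P)
    (hindep : iIndepFun Y P) {f : 𝓧 → ℂ} (hf : Measurable f) (hf4 : MemLp f 4 μ)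
    (hf0 : ∫ x, f x ∂μ = 0) :
    MemLp (fun ω => (N : ℂ)⁻¹ * ∑ i, f (Y i ω)) 4 P ∧
      ∫ ω, ‖(N : ℂ)⁻¹ * ∑ i, f (Y i ω)‖ ^ 2 ∂P = (N : ℝ)⁻¹ * ∫ x, ‖f x‖ ^ 2 ∂μ ∧
      ∫ ω, ‖(N : ℂ)⁻¹ * ∑ i, f (Y i ω)‖ ^ 4 ∂P ≤ 12 * ((N : ℝ)⁻¹) ^ 2 * ∫ x, ‖f x‖ ^ 4 ∂μ := by
  have hint : Integrable f μ := hf4.integrable (by norm_num)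
  have fr4 : MemLp (fun x => (f x).re) 4 μ := hf4.re
  have fi4 : MemLp (fun x => (f x).im) 4 μ := hf4.im
  obtain ⟨mr, hr2, hr4⟩ := integral_average_pow hN hY hindep (f := fun x => (f x).re)
    (Complex.measurable_re.comp hf) fr4
    (by rw [← RCLike.re_eq_complex_re, integral_re hint, hf0]; simp)
  obtain ⟨mi, hi2, hi4⟩ := integral_average_pow hN hY hindep (f := fun x => (f x).im)
    (Complex.measurable_im.comp hf) fi4
    (by rw [← RCLike.im_eq_complex_im, integral_im hint, hf0]; simp)
  set A := fun ω => (N : ℝ)⁻¹ * ∑ i, (f (Y i ω)).re with hA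
  set B := fun ω => (N : ℝ)⁻¹ * ∑ i, (f (Y i ω)).im with hB
  have hAB : ∀ ω, (N : ℂ)⁻¹ * ∑ i, f (Y i ω) = A ω + B ω * Complex.I := fun ω => by
    have h1 : (N : ℂ)⁻¹ = (((N : ℝ)⁻¹ : ℝ) : ℂ) := by push_cast; rfl
    rw [h1]
    apply Complex.ext
    · simp [hA]
    · simp [hB]
  have hn : ∀ a b : ℝ, ‖(a : ℂ) + b * Complex.I‖ ^ 2 = a ^ 2 + b ^ 2 := fun a b => by
    rw [Complex.sq_norm, Complex.normSq_apply]; simp; ring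
  have hf2 : ∀ x, ‖f x‖ ^ 2 = (f x).re ^ 2 + (f x).im ^ 2 := fun x => by
    rw [Complex.sq_norm, Complex.normSq_apply]; ring
  have hmem : MemLp (fun ω => (N : ℂ)⁻¹ * ∑ i, f (Y i ω)) 4 P := by
    have h1 : MemLp (fun ω => (A ω : ℂ)) 4 P := mr.ofReal
    have h2 : MemLp (fun ω => (B ω : ℂ)) 4 P := mi.ofReal
    have h3 : MemLp (fun ω => Complex.I * (B ω : ℂ)) 4 P := h2.const_mul Complex.I
    have h4 : MemLp (fun ω => (A ω : ℂ) + Complex.I * (B ω : ℂ)) 4 P := h1.add h3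
    exact h4.ae_eq (ae_of_all _ fun ω => by dsimp only; rw [hAB, mul_comm])
  refine ⟨hmem, ?_, ?_⟩
  · simp only [hAB, hn, hf2]
    have iA := integrable_pow_of_memLp_four mr (show 2 ≤ 4 by norm_num)
    have iB := integrable_pow_of_memLp_four mi (show 2 ≤ 4 by norm_num)
    have ir := integrable_pow_of_memLp_four fr4 (show 2 ≤ 4 by norm_num)
    have ii := integrable_pow_of_memLp_four fi4 (show 2 ≤ 4 by norm_num)
    rw [integral_add iA iB, hr2, hi2, ← mul_add, integral_add ir ii]
  · have hf4' : Integrable (fun x => ‖f x‖ ^ 4) μ := integrable_pow_of_memLp_four hf4.norm le_rfl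
    have h1 : ∫ x, (f x).re ^ 4 ∂μ ≤ ∫ x, ‖f x‖ ^ 4 ∂μ :=
      integral_mono (integrable_pow_of_memLp_four fr4 le_rfl) hf4' fun x => by
        nlinarith [hf2 x, sq_nonneg (f x).re, sq_nonneg (f x).im]
    have h2 : ∫ x, (f x).im ^ 4 ∂μ ≤ ∫ x, ‖f x‖ ^ 4 ∂μ :=
      integral_mono (integrable_pow_of_memLp_four fi4 le_rfl) hf4' fun x => by
        nlinarith [hf2 x, sq_nonneg (f x).re, sq_nonneg (f x).im]
    have iA := integrable_pow_of_memLp_four mr (le_refl 4)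
    have iB := integrable_pow_of_memLp_four mi (le_refl 4)
    calc ∫ ω, ‖(N : ℂ)⁻¹ * ∑ i, f (Y i ω)‖ ^ 4 ∂P
        ≤ ∫ ω, 2 * (A ω ^ 4 + B ω ^ 4) ∂P :=
          integral_mono (integrable_pow_of_memLp_four hmem.norm le_rfl)
            ((iA.fun_add iB).const_mul 2) fun ω => by
            have := hn (A ω) (B ω)
            simp only [hAB]
            rw [show ‖(A ω : ℂ) + B ω * Complex.I‖ ^ 4
              = (‖(A ω : ℂ) + B ω * Complex.I‖ ^ 2) ^ 2 by ring, this]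
            nlinarith [sq_nonneg (A ω ^ 2 - B ω ^ 2)]
      _ = 2 * (∫ ω, A ω ^ 4 ∂P + ∫ ω, B ω ^ 4 ∂P) := by
          rw [integral_const_mul, integral_add iA iB]
      _ ≤ 12 * ((N : ℝ)⁻¹) ^ 2 * ∫ x, ‖f x‖ ^ 4 ∂μ := by
          have h3 := mul_le_mul_of_nonneg_left h1 (show 0 ≤ 3 * ((N : ℝ)⁻¹) ^ 2 by positivity)
          have h4 := mul_le_mul_of_nonneg_left h2 (show 0 ≤ 3 * ((N : ℝ)⁻¹) ^ 2 by positivity)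
          linarith

end Averages

/-! ### The complex Gaussian law: scaling and rotation invariance -/

section Gaussian

variable {J : ℕ}

instance (v : ℝ) : IsProbabilityMeasure (complexGaussian v) :=
  Measure.isProbabilityMeasure_map (by
    exact (Complex.measurableEquivRealProd.symm.measurable).aemeasurable)

lemma measurable_complex_mk : Measurable (fun p : ℝ × ℝ => (⟨p.1, p.2⟩ : ℂ)) :=
  Complex.measurableEquivRealProd.symm.measurable

instance (J : ℕ) (v : ℝ) : IsProbabilityMeasure (awgn J v) :=
  Measure.isProbabilityMeasure_map (by fun_prop)

lemma charFun_complexGaussian {v : ℝ} (hv : 0 ≤ v) (t : ℂ) :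
    charFun (complexGaussian v) t = Complex.exp (-(v / 2 * ‖t‖ ^ 2 / 2 : ℝ)) := by
  have h1 : charFun (complexGaussian v) t
      = charFun (gaussianReal 0 (v / 2).toNNReal) t.re
        * charFun (gaussianReal 0 (v / 2).toNNReal) t.im := by
    rw [charFun_apply, complexGaussian, integral_map measurable_complex_mk.aemeasurable
      (by fun_prop), charFun_apply_real, charFun_apply_real, ← integral_prod_mul]
    congr 1
    ext p
    rw [← Complex.exp_add]
    congr 1
    simp [Complex.inner]
    ring
  rw [h1, charFun_gaussianReal, charFun_gaussianReal, ← Complex.exp_add]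
  congr 1
  rw [Complex.sq_norm, Complex.normSq_apply, Real.coe_toNNReal _ (by positivity)]
  push_cast
  ring

/-- The characteristic functions agree; each real coordinate has variance `v / 2`. This
representation supplies finite moments, their scaling in `v`, and rotation invariance. -/
lemma awgn_eq_map_stdGaussian {v : ℝ} (hv : 0 ≤ v) :
    awgn J v = (stdGaussian (CVec J)).map (fun x => √(v / 2) • x) := by
  have : IsProbabilityMeasure ((stdGaussian (CVec J)).map (fun x => √(v / 2) • x)) :=
    Measure.isProbabilityMeasure_map (by fun_prop)
  apply Measure.ext_of_charFun
  ext t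
  rw [awgn, charFun_pi, charFun_map_smul, charFun_stdGaussian]
  simp only [charFun_complexGaussian hv]
  rw [← Complex.exp_sum]
  congr 1
  rw [norm_smul, ← Complex.ofReal_pow, mul_pow, EuclideanSpace.norm_sq_eq,
    Real.norm_eq_abs, sq_abs, Real.sq_sqrt (by positivity)]
  rw [← Complex.ofReal_neg]
  push_cast
  rw [Finset.mul_sum, ← Finset.sum_neg_distrib, Finset.sum_div]
  refine Finset.sum_congr rfl fun i _ => by ring

lemma map_awgn_linearIsometryEquiv {v : ℝ} (hv : 0 ≤ v) (f : CVec J ≃ₗᵢ[ℝ] CVec J) :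
    (awgn J v).map f = awgn J v := by
  rw [awgn_eq_map_stdGaussian hv, Measure.map_map (by fun_prop) (by fun_prop)]
  conv_rhs => rw [← stdGaussian_map f]
  rw [Measure.map_map (by fun_prop) (by fun_prop)]
  congr 1
  ext1 x
  simp

lemma integrable_norm_pow_stdGaussian (p : ℕ) :
    Integrable (fun x => ‖x‖ ^ p) (stdGaussian (CVec J)) :=
  (IsGaussian.memLp_id (stdGaussian (CVec J)) p (by simp)).integrable_norm_pow'

lemma integrable_norm_pow_awgn {v : ℝ} (hv : 0 ≤ v) (p : ℕ) :
    Integrable (fun x => ‖x‖ ^ p) (awgn J v) := by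
  rw [awgn_eq_map_stdGaussian hv, integrable_map_measure (by fun_prop) (by fun_prop)]
  simp only [Function.comp_def, norm_smul, mul_pow]
  exact (integrable_norm_pow_stdGaussian p).const_mul _

lemma integral_norm_pow_awgn {v : ℝ} (hv : 0 ≤ v) (p : ℕ) :
    ∫ x, ‖x‖ ^ (2 * p) ∂(awgn J v)
      = (v / 2) ^ p * ∫ x, ‖x‖ ^ (2 * p) ∂(stdGaussian (CVec J)) := by
  rw [awgn_eq_map_stdGaussian hv, integral_map (by fun_prop) (by fun_prop)]
  simp only [norm_smul, mul_pow]
  rw [integral_const_mul, pow_mul, Real.norm_eq_abs, sq_abs, Real.sq_sqrt (by positivity)]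

lemma integral_complexGaussian_id {v : ℝ} : ∫ z, z ∂(complexGaussian v) = 0 := by
  have hI : Integrable (fun p : ℝ × ℝ => (⟨p.1, p.2⟩ : ℂ))
      ((gaussianReal 0 (v / 2).toNNReal).prod (gaussianReal 0 (v / 2).toNNReal)) := by
    have : (fun p : ℝ × ℝ => (⟨p.1, p.2⟩ : ℂ)) = fun p => (p.1 : ℂ) + p.2 * Complex.I := by
      ext p; exact Complex.mk_eq_add_mul_I _ _
    rw [this]
    have h0 : Integrable (fun x : ℝ => x) (gaussianReal 0 (v / 2).toNNReal) :=
      IsGaussian.integrable_id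
    exact (h0.comp_fst _).ofReal.add ((h0.comp_snd _).ofReal.mul_const _)
  rw [complexGaussian, integral_map measurable_complex_mk.aemeasurable (by fun_prop)]
  apply Complex.ext
  · rw [← RCLike.re_eq_complex_re, ← integral_re hI]
    simp [integral_fun_fst (μ := gaussianReal 0 (v / 2).toNNReal) (f := fun x => x)]
  · rw [← RCLike.im_eq_complex_im, ← integral_im hI]
    simp [integral_fun_snd (μ := gaussianReal 0 (v / 2).toNNReal) (f := fun x => x)]

lemma integral_sq_gaussianReal (v : NNReal) : ∫ x, x ^ 2 ∂(gaussianReal 0 v) = v := by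
  have := variance_id_gaussianReal (μ := 0) (v := v)
  rw [variance_eq_integral (by fun_prop)] at this
  simpa using this

lemma integral_norm_sq_complexGaussian {v : ℝ} (hv : 0 ≤ v) :
    ∫ z, ‖z‖ ^ 2 ∂(complexGaussian v) = v := by
  have h0 : Integrable (fun x : ℝ => x ^ 2) (gaussianReal 0 (v / 2).toNNReal) := by
    have := (IsGaussian.memLp_id (gaussianReal 0 (v / 2).toNNReal) 2 (by simp)).integrable_sq
    simpa using this
  rw [complexGaussian, integral_map measurable_complex_mk.aemeasurable (by fun_prop)]
  have h1 : ∀ p : ℝ × ℝ, ‖(⟨p.1, p.2⟩ : ℂ)‖ ^ 2 = p.1 ^ 2 + p.2 ^ 2 := fun p => by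
    rw [Complex.sq_norm, Complex.normSq_apply]; ring
  simp only [h1]
  rw [integral_add (h0.comp_fst _) (h0.comp_snd _),
    integral_fun_fst (f := fun x : ℝ => x ^ 2), integral_fun_snd (f := fun x : ℝ => x ^ 2),
    integral_sq_gaussianReal, Real.coe_toNNReal _ (by positivity)]
  simp

end Gaussian

/-! ### Second and fourth moments of the noise -/

section NoiseMoments

variable {J : ℕ}

lemma integrable_coord_mul_star_awgn {v : ℝ} (hv : 0 ≤ v) (k l : Fin J) :
    Integrable (fun x : CVec J => x k * star (x l)) (awgn J v) := by
  refine (integrable_norm_pow_awgn hv 2).mono' (by fun_prop) (ae_of_all _ fun x => ?_)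
  rw [norm_mul, norm_star, sq]
  gcongr <;> exact PiLp.norm_apply_le x _

lemma integrable_coord_awgn {v : ℝ} (hv : 0 ≤ v) (k : Fin J) :
    Integrable (fun x : CVec J => x k) (awgn J v) := by
  refine (integrable_norm_pow_awgn hv 1).mono' (by fun_prop) (ae_of_all _ fun x => ?_)
  rw [pow_one]
  exact PiLp.norm_apply_le x _

lemma integral_awgn {E : Type*} [NormedAddCommGroup E] [NormedSpace ℝ E] {v : ℝ}
    {f : CVec J → E} (hf : AEStronglyMeasurable f (awgn J v)) :
    ∫ x, f x ∂(awgn J v) = ∫ x, f (WithLp.toLp 2 x) ∂(Measure.pi fun _ => complexGaussian v) :=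
  integral_map (by fun_prop) hf

lemma integral_coord_awgn {v : ℝ} (k : Fin J) : ∫ x : CVec J, x k ∂(awgn J v) = 0 := by
  rw [integral_awgn (by fun_prop)]
  exact (integral_comp_eval (μ := fun _ => complexGaussian v) (i := k) (f := fun z => z)
    (by fun_prop)).trans integral_complexGaussian_id

lemma integral_norm_sq_coord_awgn {v : ℝ} (hv : 0 ≤ v) (k : Fin J) :
    ∫ x : CVec J, ‖x k‖ ^ 2 ∂(awgn J v) = v := by
  rw [integral_awgn (by fun_prop)]
  exact (integral_comp_eval (μ := fun _ => complexGaussian v) (i := k) (f := fun z => ‖z‖ ^ 2)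
    (by fun_prop)).trans (integral_norm_sq_complexGaussian hv)

lemma indepFun_coord (v : ℝ) {k l : Fin J} (hkl : k ≠ l) :
    IndepFun (fun x : Fin J → ℂ => x k) (fun x => x l)
      (Measure.pi fun _ : Fin J => complexGaussian v) :=
  (iIndepFun_pi (μ := fun _ : Fin J => complexGaussian v) (X := fun _ z => z)
    (fun _ => by fun_prop)).indepFun hkl

lemma integral_coord_mul_star_awgn {v : ℝ} (hv : 0 ≤ v) (k l : Fin J) :
    ∫ x : CVec J, x k * star (x l) ∂(awgn J v) = if k = l then (v : ℂ) else 0 := by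
  split_ifs with hkl
  · subst hkl
    have : ∀ x : CVec J, x k * star (x k) = ((‖x k‖ ^ 2 : ℝ) : ℂ) := fun x => by
      rw [Complex.star_def, Complex.mul_conj']; push_cast; rfl
    simp only [this]
    rw [integral_complex_ofReal, integral_norm_sq_coord_awgn hv]
  · rw [integral_awgn (by fun_prop)]
    have h1 := ((indepFun_coord v hkl).comp (φ := fun z => z) (ψ := fun z => star z)
      (by fun_prop) (by fun_prop)).integral_fun_mul_eq_mul_integral
      (Measurable.aestronglyMeasurable (by fun_prop))
      (Measurable.aestronglyMeasurable (by fun_prop))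
    simp only [Function.comp_def] at h1
    rw [h1]
    have h2 := (integral_awgn (v := v) (f := fun x : CVec J => x k) (by fun_prop)).symm
    rw [integral_coord_awgn] at h2
    rw [h2, zero_mul]

lemma integral_norm_sq_coord_mul_awgn {v : ℝ} (hv : 0 ≤ v) {k l : Fin J} (hkl : k ≠ l) :
    ∫ x : CVec J, ‖x k‖ ^ 2 * ‖x l‖ ^ 2 ∂(awgn J v) = v ^ 2 := by
  rw [integral_awgn (by fun_prop)]
  have h1 := ((indepFun_coord v hkl).comp (φ := fun z => ‖z‖ ^ 2) (ψ := fun z => ‖z‖ ^ 2)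
    (by fun_prop) (by fun_prop)).integral_fun_mul_eq_mul_integral
    (Measurable.aestronglyMeasurable (by fun_prop))
    (Measurable.aestronglyMeasurable (by fun_prop))
  simp only [Function.comp_def] at h1
  rw [h1]
  have h2 := fun k => (integral_awgn (v := v) (f := fun x : CVec J => ‖x k‖ ^ 2)
    (by fun_prop)).symm
  simp only [integral_norm_sq_coord_awgn hv] at h2
  rw [h2, h2, sq]

lemma exists_orthonormalBasis_apply_eq {h : CVec J} (hh : ‖h‖ = 1) :
    ∃ (i₀ : Fin J) (b : OrthonormalBasis (Fin J) ℂ (CVec J)), b i₀ = h := by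
  rcases Nat.eq_zero_or_pos J with rfl | hJ
  · rw [Subsingleton.elim h 0, norm_zero] at hh
    exact absurd hh (by norm_num)
  · let i₀ : Fin J := ⟨0, hJ⟩
    have ho : Orthonormal ℂ (({i₀} : Set (Fin J)).domRestrict fun _ => h) := by
      refine ⟨fun _ => hh, fun i j hij => ?_⟩
      exact absurd (Subsingleton.elim i j) hij
    obtain ⟨b, hb⟩ := ho.exists_orthonormalBasis_extension_of_card_eq (by simp)
    exact ⟨i₀, b, hb i₀ rfl⟩

/-- The white noise has a rotation invariant law, so that it has independent components along and
orthogonal to a unit vector. -/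
lemma integral_norm_sq_orthPart_awgn {v : ℝ} (hv : 0 ≤ v) {h : CVec J} (hh : ‖h‖ = 1) :
    ∫ x, ‖orthPart h x‖ ^ 2 ∂(awgn J v) = ((J : ℝ) - 1) * v ∧
      ∫ x, ‖orthPart h x‖ ^ 2 * ‖inner ℂ h x‖ ^ 2 ∂(awgn J v) = ((J : ℝ) - 1) * v ^ 2 := by
  obtain ⟨i₀, b, hb⟩ := exists_orthonormalBasis_apply_eq hh
  have hi : ∀ x, inner ℂ h x = b.repr x i₀ := fun x => by rw [b.repr_apply_apply, hb]
  have ho : ∀ x, ‖orthPart h x‖ ^ 2 = ∑ i ∈ Finset.univ.erase i₀, ‖b.repr x i‖ ^ 2 := fun x => by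
    have h1 := norm_sq_eq_orthPart_add_alongCoeff hh x
    rw [← b.repr.norm_map x, EuclideanSpace.norm_sq_eq, alongCoeff, hi,
      ← Finset.sum_erase_add _ _ (Finset.mem_univ i₀)] at h1
    linarith
  have hcard : (((Finset.univ.erase i₀).card : ℕ) : ℝ) = (J : ℝ) - 1 := by
    have := Finset.card_erase_add_one (Finset.mem_univ i₀)
    rw [Finset.card_univ, Fintype.card_fin] at this
    rw [eq_sub_iff_add_eq]
    exact_mod_cast this
  -- Coordinates in a basis containing `h` are a unitary image of the noise, hence have the same
  -- law; invariance is available for real isometries.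
  let f : CVec J ≃ₗᵢ[ℝ] CVec J :=
    { b.repr.toLinearEquiv.restrictScalars ℝ with norm_map' := b.repr.norm_map }
  have hf : ∀ x, f x = b.repr x := fun _ => rfl
  have hmap : ∀ {F : CVec J → ℝ}, Continuous F →
      ∫ x, F (b.repr x) ∂(awgn J v) = ∫ x, F x ∂(awgn J v) := fun {F} hF => by
    conv_rhs => rw [← map_awgn_linearIsometryEquiv hv f]
    rw [integral_map (by fun_prop) hF.aestronglyMeasurable]
    rfl
  have hint : ∀ k : Fin J, Integrable (fun x : CVec J => ‖x k‖ ^ 2) (awgn J v) := fun k => by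
    refine (integrable_norm_pow_awgn hv 2).mono' (by fun_prop) (ae_of_all _ fun x => ?_)
    simp only [norm_pow, norm_norm]
    gcongr
    exact PiLp.norm_apply_le x _
  have hint2 : ∀ k l : Fin J,
      Integrable (fun x : CVec J => ‖x k‖ ^ 2 * ‖x l‖ ^ 2) (awgn J v) := fun k l => by
    refine (integrable_norm_pow_awgn hv 4).mono' (by fun_prop) (ae_of_all _ fun x => ?_)
    rw [show ‖x‖ ^ 4 = ‖x‖ ^ 2 * ‖x‖ ^ 2 by ring]
    simp only [norm_pow, norm_norm, norm_mul]
    gcongr <;> exact PiLp.norm_apply_le x _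
  constructor
  · simp only [ho]
    rw [hmap (F := fun x => ∑ i ∈ Finset.univ.erase i₀, ‖x i‖ ^ 2) (by fun_prop),
      integral_finsetSum _ fun i _ => hint i]
    simp only [integral_norm_sq_coord_awgn hv, Finset.sum_const, nsmul_eq_mul, hcard]
  · simp only [ho, hi]
    rw [hmap (F := fun x => (∑ i ∈ Finset.univ.erase i₀, ‖x i‖ ^ 2) * ‖x i₀‖ ^ 2) (by fun_prop)]
    simp only [Finset.sum_mul]
    rw [integral_finsetSum _ fun i _ => hint2 i i₀,
      Finset.sum_congr rfl fun i hi =>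
        integral_norm_sq_coord_mul_awgn hv (Finset.ne_of_mem_erase hi)]
    simp only [Finset.sum_const, nsmul_eq_mul, hcard]

end NoiseMoments

/-! ### Moments of one relative deviation matrix -/

section SampleMoments

variable {J : ℕ}

instance : IsProbabilityMeasure bpsk := by
  refine ⟨?_⟩
  simp [bpsk, ENNReal.inv_two_add_inv_two]

lemma ae_sq_eq_one_bpsk : ∀ᵐ b ∂bpsk, b ^ 2 = 1 := by
  rw [bpsk, ae_add_measure_iff]
  constructor <;>
  · refine Measure.ae_smul_measure ?_ _
    rw [ae_dirac_eq]
    simp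

lemma integrable_id_bpsk : Integrable (fun b : ℝ => b) bpsk := by
  refine (integrable_const (1 : ℝ)).mono' (by fun_prop) ?_
  filter_upwards [ae_sq_eq_one_bpsk] with b hb
  rw [Real.norm_eq_abs]
  exact (sq_le_one_iff_abs_le_one b).mp hb.le

lemma integral_id_bpsk : ∫ b : ℝ, b ∂bpsk = 0 := by
  have h1 : Integrable (fun b : ℝ => b) ((2⁻¹ : ENNReal) • Measure.dirac (1 : ℝ)) :=
    (integrable_dirac (by simp)).smul_measure (by simp)
  have h2 : Integrable (fun b : ℝ => b) ((2⁻¹ : ENNReal) • Measure.dirac (-1 : ℝ)) :=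
    (integrable_dirac (by simp)).smul_measure (by simp)
  rw [bpsk, integral_add_measure h1 h2, integral_smul_measure, integral_smul_measure,
    integral_dirac, integral_dirac]
  simp

/-- The deviation of `r rᴴ` from its mean `g gᴴ + v I`, relative to `‖g‖²`. -/
noncomputable def excess (g : CVec J) (v : ℝ) (x : ℝ × CVec J) : Matrix (Fin J) (Fin J) ℂ :=
  Matrix.of fun k l => ((‖g‖ ^ 2 : ℝ) : ℂ)⁻¹ * (received g x.1 x.2 k * star (received g x.1 x.2 l)
    - g k * star (g l) - if k = l then (v : ℂ) else 0)

lemma measurable_excess (g : CVec J) (v : ℝ) (k l : Fin J) :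
    Measurable (fun x => excess g v x k l) := by
  simp only [excess, received, Matrix.of_apply, PiLp.add_apply, PiLp.smul_apply]
  fun_prop

/-- Since `b² = 1`, the signal term `g gᴴ` cancels. There remain a cross term odd in `b` and the
centred noise term, so the mean vanishes. -/
lemma excess_eq_of_sq_eq_one (g : CVec J) (v : ℝ) {x : ℝ × CVec J} (hx : x.1 ^ 2 = 1)
    (k l : Fin J) :
    excess g v x k l = ((‖g‖ ^ 2 : ℝ) : ℂ)⁻¹ * ((x.1 : ℂ) * (g k * star (x.2 l) + x.2 k * star (g l))
      + (x.2 k * star (x.2 l) - if k = l then (v : ℂ) else 0)) := by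
  have h1 : (x.1 : ℂ) * x.1 = 1 := by rw [← Complex.ofReal_mul, ← sq, hx, Complex.ofReal_one]
  simp only [excess, received, Matrix.of_apply, PiLp.add_apply, PiLp.smul_apply, smul_eq_mul,
    star_add, star_mul', Complex.star_def, Complex.conj_ofReal]
  linear_combination ((‖g‖ ^ 2 : ℝ) : ℂ)⁻¹ * g k * (starRingEnd ℂ) (g l) * h1

lemma ae_sq_fst_eq_one (ν : Measure (CVec J)) [SFinite ν] :
    ∀ᵐ x ∂(bpsk.prod ν), x.1 ^ 2 = 1 :=
  Measure.quasiMeasurePreserving_fst.ae ae_sq_eq_one_bpsk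

lemma norm_excess_le {g : CVec J} {v : ℝ} (hv : 0 ≤ v) {x : ℝ × CVec J}
    (hx : x.1 ^ 2 = 1) (k l : Fin J) :
    ‖excess g v x k l‖ ≤ (‖g‖ ^ 2)⁻¹ * (2 * ‖g‖ * ‖x.2‖ + ‖x.2‖ ^ 2 + v) := by
  have hb : ‖(x.1 : ℂ)‖ = 1 := by
    rw [Complex.norm_real, Real.norm_eq_abs, ← sq_eq_sq₀ (abs_nonneg _) zero_le_one, sq_abs, hx,
      one_pow]
  have hp : ∀ y z : CVec J, ‖y k * star (z l)‖ ≤ ‖y‖ * ‖z‖ := fun y z => by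
    rw [norm_mul, norm_star]
    gcongr <;> exact PiLp.norm_apply_le _ _
  have h1 := hp g x.2
  have h2 := hp x.2 g
  have h3 := hp x.2 x.2
  have h4 : ‖(if k = l then (v : ℂ) else 0)‖ ≤ v := by
    split_ifs
    · rw [Complex.norm_real, Real.norm_eq_abs, abs_of_nonneg hv]
    · simpa using hv
  rw [excess_eq_of_sq_eq_one g v hx, norm_mul, norm_inv, Complex.norm_real, norm_pow, norm_norm]
  gcongr
  refine (norm_add_le _ _).trans ?_
  rw [norm_mul, hb, one_mul]
  have h5 := norm_add_le (g k * star (x.2 l)) (x.2 k * star (g l))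
  have h6 := norm_sub_le (x.2 k * star (x.2 l)) (if k = l then (v : ℂ) else 0)
  linarith

lemma add_add_pow_four_le (a b c : ℝ) : (a + b + c) ^ 4 ≤ 27 * (a ^ 4 + b ^ 4 + c ^ 4) := by
  have h1 : (a + b + c) ^ 2 ≤ 3 * (a ^ 2 + b ^ 2 + c ^ 2) := by
    nlinarith [sq_nonneg (a - b), sq_nonneg (b - c), sq_nonneg (a - c)]
  have h2 : ((a + b + c) ^ 2) ^ 2 ≤ (3 * (a ^ 2 + b ^ 2 + c ^ 2)) ^ 2 := by gcongr
  nlinarith [sq_nonneg (a ^ 2 - b ^ 2), sq_nonneg (b ^ 2 - c ^ 2), sq_nonneg (a ^ 2 - c ^ 2)]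

lemma norm_excess_pow_four_le {g : CVec J} {v : ℝ} (hv : 0 ≤ v) {x : ℝ × CVec J}
    (hx : x.1 ^ 2 = 1) (k l : Fin J) :
    ‖excess g v x k l‖ ^ 4 ≤
      ((‖g‖ ^ 2)⁻¹) ^ 4 * (27 * (16 * ‖g‖ ^ 4 * ‖x.2‖ ^ 4 + ‖x.2‖ ^ 8 + v ^ 4)) := by
  refine (pow_le_pow_left₀ (norm_nonneg _) (norm_excess_le hv hx k l) 4).trans ?_
  rw [mul_pow]
  gcongr
  refine (add_add_pow_four_le _ _ _).trans (le_of_eq ?_)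
  ring

lemma integrable_excess_bound {g : CVec J} {v : ℝ} (hv : 0 ≤ v) :
    Integrable (fun x : CVec J => 27 * (16 * ‖g‖ ^ 4 * ‖x‖ ^ 4 + ‖x‖ ^ 8 + v ^ 4)) (awgn J v) :=
  ((((integrable_norm_pow_awgn hv 4).const_mul _).add (integrable_norm_pow_awgn hv 8)).add
    (integrable_const _)).const_mul _

lemma integrable_norm_excess_pow_four (g : CVec J) {v : ℝ} (hv : 0 ≤ v) (k l : Fin J) :
    Integrable (fun x => ‖excess g v x k l‖ ^ 4) (bpsk.prod (awgn J v)) := by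
  refine (((integrable_excess_bound hv (g := g)).comp_snd bpsk).const_mul
    (((‖g‖ ^ 2)⁻¹) ^ 4)).mono' ?_ ?_
  · exact ((measurable_excess g v k l).norm.pow_const 4).aestronglyMeasurable
  · filter_upwards [ae_sq_fst_eq_one (awgn J v)] with x hx
    rw [norm_pow, norm_norm]
    exact norm_excess_pow_four_le hv hx k l

lemma memLp_excess (g : CVec J) {v : ℝ} (hv : 0 ≤ v) (k l : Fin J) :
    MemLp (fun x => excess g v x k l) 4 (bpsk.prod (awgn J v)) :=
  memLp_four_of_integrable_norm_pow (measurable_excess g v k l).aestronglyMeasurable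
    (integrable_norm_excess_pow_four g hv k l)

lemma excess_bound_le {A B v : ℝ} (hA0 : 0 ≤ A) (hB0 : 0 ≤ B) (hv : 0 ≤ v) (t : ℝ) :
    27 * (16 * t ^ 4 * ((v / 2) ^ 2 * A) + (v / 2) ^ 4 * B + v ^ 4)
      ≤ 27 * (4 * A + B + 1) * (v * t ^ 2 + v ^ 2) ^ 2 := by
  set K := (v * t ^ 2 + v ^ 2) ^ 2
  have e1 : (v * t ^ 2) ^ 2 ≤ K :=
    pow_le_pow_left₀ (by positivity) (le_add_of_nonneg_right (by positivity)) 2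
  have e2 : (v ^ 2) ^ 2 ≤ K :=
    pow_le_pow_left₀ (by positivity) (le_add_of_nonneg_left (by positivity)) 2
  have e3 := mul_le_mul_of_nonneg_left e1 hA0
  have e4 := mul_le_mul_of_nonneg_left e2 hB0
  have e5 : 0 ≤ B * (v ^ 2) ^ 2 := by positivity
  calc _ = 27 * (4 * (A * (v * t ^ 2) ^ 2) + B * (v ^ 2) ^ 2 / 16 + (v ^ 2) ^ 2) := by ring
    _ ≤ 27 * (4 * (A * K) + B * K + K) := by linarith
    _ = _ := by ring

/-- Rescaling to the standard Gaussian leaves moments `A`, `B` that depend on J only. The bound is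
the square of the ratio occurring in `F`, so that it can be compared with `F²`. -/
lemma exists_integral_norm_excess_pow_four_le (J : ℕ) :
    ∃ C : ℝ, 0 ≤ C ∧ ∀ (g : CVec J) (v : ℝ), g ≠ 0 → 0 ≤ v → ∀ k l : Fin J,
      ∫ x, ‖excess g v x k l‖ ^ 4 ∂(bpsk.prod (awgn J v))
        ≤ C * ((v * ‖g‖ ^ 2 + v ^ 2) / ‖g‖ ^ 4) ^ 2 := by
  set A := ∫ x, ‖x‖ ^ (2 * 2) ∂(stdGaussian (CVec J)) with hA
  set B := ∫ x, ‖x‖ ^ (2 * 4) ∂(stdGaussian (CVec J)) with hB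
  have hA0 : 0 ≤ A := integral_nonneg fun x => by positivity
  have hB0 : 0 ≤ B := integral_nonneg fun x => by positivity
  refine ⟨27 * (4 * A + B + 1), by positivity, fun g v hg hv k l => ?_⟩
  have hg0 : 0 < ‖g‖ := norm_pos_iff.mpr hg
  have h1 : ∫ x, ‖excess g v x k l‖ ^ 4 ∂(bpsk.prod (awgn J v)) ≤
      ∫ x, ((‖g‖ ^ 2)⁻¹) ^ 4 * (27 * (16 * ‖g‖ ^ 4 * ‖x.2‖ ^ 4 + ‖x.2‖ ^ 8 + v ^ 4))
        ∂(bpsk.prod (awgn J v)) := by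
    refine integral_mono_ae (integrable_norm_excess_pow_four g hv k l)
      (((integrable_excess_bound hv).comp_snd bpsk).const_mul _) ?_
    filter_upwards [ae_sq_fst_eq_one (awgn J v)] with x hx
    exact norm_excess_pow_four_le hv hx k l
  have h2 : ∫ x : ℝ × CVec J, (27 * (16 * ‖g‖ ^ 4 * ‖x.2‖ ^ 4 + ‖x.2‖ ^ 8 + v ^ 4))
        ∂(bpsk.prod (awgn J v))
      = 27 * (16 * ‖g‖ ^ 4 * ((v / 2) ^ 2 * A) + (v / 2) ^ 4 * B + v ^ 4) := by
    rw [integral_fun_snd (f := fun x : CVec J => 27 * (16 * ‖g‖ ^ 4 * ‖x‖ ^ 4 + ‖x‖ ^ 8 + v ^ 4)),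
      integral_const_mul,
      integral_add (((integrable_norm_pow_awgn hv 4).const_mul _).fun_add
        (integrable_norm_pow_awgn hv 8)) (integrable_const _),
      integral_add ((integrable_norm_pow_awgn hv 4).const_mul _) (integrable_norm_pow_awgn hv 8),
      integral_const_mul, integral_norm_pow_awgn hv 2, integral_norm_pow_awgn hv 4]
    simp [hA, hB]
  rw [integral_const_mul, h2] at h1
  refine h1.trans ?_
  have h3 := excess_bound_le hA0 hB0 hv ‖g‖
  calc _ ≤ ((‖g‖ ^ 2)⁻¹) ^ 4 * (27 * (4 * A + B + 1) * (v * ‖g‖ ^ 2 + v ^ 2) ^ 2) := by gcongr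
    _ = _ := by field_simp

lemma integral_excess (g : CVec J) {v : ℝ} (hv : 0 ≤ v) (k l : Fin J) :
    ∫ x, excess g v x k l ∂(bpsk.prod (awgn J v)) = 0 := by
  have i1 : Integrable (fun n : CVec J => g k * star (n l) + n k * star (g l)) (awgn J v) := by
    have h1 : Integrable (fun n : CVec J => star (n l)) (awgn J v) :=
      (integrable_coord_awgn hv l).congr' (by fun_prop) (ae_of_all _ fun x => by simp)
    exact (h1.const_mul _).add ((integrable_coord_awgn hv k).mul_const _)
  have i2 : Integrable (fun n : CVec J => n k * star (n l) - if k = l then (v : ℂ) else 0)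
      (awgn J v) := (integrable_coord_mul_star_awgn hv k l).sub (integrable_const _)
  have ib : Integrable (fun b : ℝ => (b : ℂ)) bpsk := integrable_id_bpsk.ofReal
  have h1 : ∫ x, excess g v x k l ∂(bpsk.prod (awgn J v)) = ∫ x : ℝ × CVec J,
      ((‖g‖ ^ 2 : ℝ) : ℂ)⁻¹ * ((x.1 : ℂ) * (g k * star (x.2 l) + x.2 k * star (g l))
      + (x.2 k * star (x.2 l) - if k = l then (v : ℂ) else 0)) ∂(bpsk.prod (awgn J v)) := by
    refine integral_congr_ae ?_
    filter_upwards [ae_sq_fst_eq_one (awgn J v)] with x hx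
    exact excess_eq_of_sq_eq_one g v hx k l
  rw [h1, integral_const_mul, integral_add (ib.mul_prod i1) (i2.comp_snd bpsk),
    integral_prod_mul (fun b : ℝ => (b : ℂ))
      (fun n : CVec J => g k * star (n l) + n k * star (g l)),
    integral_complex_ofReal, integral_id_bpsk,
    integral_fun_snd (f := fun n : CVec J => n k * star (n l) - if k = l then (v : ℂ) else 0),
    integral_sub (integrable_coord_mul_star_awgn hv k l) (integrable_const _),
    integral_coord_mul_star_awgn hv]
  simp

lemma linearMap_excess (g : CVec J) {v : ℝ} (hv : 0 ≤ v) (L : Matrix (Fin J) (Fin J) ℂ →ₗ[ℂ] ℂ) :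
    Measurable (fun x => L (excess g v x)) ∧
      MemLp (fun x => L (excess g v x)) 4 (bpsk.prod (awgn J v)) ∧
      ∫ x, L (excess g v x) ∂(bpsk.prod (awgn J v)) = 0 := by
  have h1 : ∀ A : Matrix (Fin J) (Fin J) ℂ, L A = ∑ k, ∑ l, L (Matrix.single k l 1) * A k l :=
    fun A => by
      conv_lhs => rw [Matrix.matrix_eq_sum_single A]
      simp only [map_sum]
      refine Finset.sum_congr rfl fun k _ => Finset.sum_congr rfl fun l _ => ?_
      rw [mul_comm, ← smul_eq_mul, ← map_smul, Matrix.smul_single, smul_eq_mul, mul_one]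
  have hm := fun k l => (memLp_excess g hv k l).const_mul (L (Matrix.single k l 1))
  have hi := fun k l => (hm k l).integrable (by norm_num)
  rw [show (fun x => L (excess g v x)) = fun x => ∑ k, ∑ l, L (Matrix.single k l 1) *
    excess g v x k l from funext fun x => h1 _]
  refine ⟨?_, ?_, ?_⟩
  · exact Finset.measurable_fun_sum _ fun k _ => Finset.measurable_fun_sum _ fun l _ =>
      (measurable_excess g v k l).const_mul _
  · exact memLp_finsetSum _ fun k _ => memLp_finsetSum _ fun l _ => hm k l
  · rw [integral_finsetSum _ fun k _ => integrable_finsetSum _ fun l _ => hi k l]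
    refine Finset.sum_eq_zero fun k _ => ?_
    rw [integral_finsetSum _ fun l _ => hi k l]
    refine Finset.sum_eq_zero fun l _ => ?_
    rw [integral_const_mul, integral_excess g hv, mul_zero]

lemma norm_smul_direction {g : CVec J} (hg : g ≠ 0) : (‖g‖ : ℂ) • direction g = g := by
  rw [direction, smul_smul, mul_inv_cancel₀, one_smul]
  exact_mod_cast norm_ne_zero_iff.mpr hg

lemma toEuclideanLin_excess_apply (g : CVec J) (v : ℝ) (x : ℝ × CVec J) (y : CVec J) :
    Matrix.toEuclideanLin (excess g v x) y = ((‖g‖ ^ 2 : ℝ) : ℂ)⁻¹ •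
      (inner ℂ (received g x.1 x.2) y • received g x.1 x.2 - inner ℂ g y • g - (v : ℂ) • y) := by
  ext k
  simp only [Matrix.toLpLin_apply, Matrix.mulVec, dotProduct, excess, Matrix.of_apply,
    PiLp.smul_apply, PiLp.sub_apply, smul_eq_mul, PiLp.inner_apply, RCLike.inner_apply,
    mul_sub, sub_mul, Finset.sum_sub_distrib, Finset.sum_mul, Finset.mul_sum]
  congr 1
  · congr 1
    · exact Finset.sum_congr rfl fun l _ => by rw [Complex.star_def]; ring
    · exact Finset.sum_congr rfl fun l _ => by rw [Complex.star_def]; ring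
  · simp [mul_assoc]

/-- Applied to `h`, the terms `g gᴴ` and `v I` yield multiples of `h`, and `r` differs from `n` by a
multiple of `h`; only `(rᴴ h) P⊥ n` survives. -/
lemma orthPart_excess {g : CVec J} (hg : g ≠ 0) (v : ℝ) (x : ℝ × CVec J) :
    orthPart (direction g) (Matrix.toEuclideanLin (excess g v x) (direction g))
      = (((‖g‖ ^ 2 : ℝ) : ℂ)⁻¹ * inner ℂ (received g x.1 x.2) (direction g))
        • orthPart (direction g) x.2 := by
  have hh := norm_direction hg
  have h0 : orthPart (direction g) ((‖g‖ : ℂ) • direction g) = 0 := by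
    rw [orthPart_smul, orthPart_self hh, smul_zero]
  rw [norm_smul_direction hg] at h0
  rw [toEuclideanLin_excess_apply, orthPart_smul, orthPart_sub, orthPart_sub, orthPart_smul,
    orthPart_smul, orthPart_smul, orthPart_self hh, h0, smul_zero, smul_zero, sub_zero, sub_zero,
    smul_smul]
  congr 1
  rw [received, orthPart_add, orthPart_smul, h0, smul_zero, zero_add]

lemma norm_sq_orthPart_excess {g : CVec J} (hg : g ≠ 0) (v : ℝ) {x : ℝ × CVec J}
    (hx : x.1 ^ 2 = 1) :
    ‖orthPart (direction g) (Matrix.toEuclideanLin (excess g v x) (direction g))‖ ^ 2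
      = ((‖g‖ ^ 2)⁻¹) ^ 2 * (‖g‖ ^ 2 * ‖orthPart (direction g) x.2‖ ^ 2
        + x.1 * (2 * ‖g‖ * ((inner ℂ (direction g) x.2).re * ‖orthPart (direction g) x.2‖ ^ 2))
        + ‖orthPart (direction g) x.2‖ ^ 2 * ‖inner ℂ (direction g) x.2‖ ^ 2) := by
  have h1 : inner ℂ (direction g) (received g x.1 x.2)
      = ((x.1 * ‖g‖ : ℝ) : ℂ) + inner ℂ (direction g) x.2 := by
    have h0 : inner ℂ (direction g) ((‖g‖ : ℂ) • direction g) = ‖g‖ := by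
      rw [inner_smul_right, inner_self_eq_norm_sq_to_K, norm_direction hg]
      simp
    rw [norm_smul_direction hg] at h0
    rw [received, inner_add_right, inner_smul_right, h0, Complex.ofReal_mul]
  have h2 : ‖inner ℂ (direction g) (received g x.1 x.2)‖ ^ 2
      = ‖g‖ ^ 2 + x.1 * (2 * ‖g‖ * (inner ℂ (direction g) x.2).re)
        + ‖inner ℂ (direction g) x.2‖ ^ 2 := by
    rw [h1, Complex.sq_norm, Complex.sq_norm, Complex.normSq_apply, Complex.normSq_apply]
    simp only [Complex.add_re, Complex.add_im, Complex.ofReal_re, Complex.ofReal_im]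
    linear_combination ‖g‖ ^ 2 * hx
  rw [orthPart_excess hg, norm_smul, norm_mul, mul_pow, mul_pow, norm_inner_symm, h2, norm_inv,
    Complex.norm_real, norm_pow, norm_norm]
  ring

lemma continuous_orthPart (h : CVec J) : Continuous (orthPart h) := by
  unfold orthPart alongCoeff
  fun_prop

/-- In `|rᴴ h|² ‖P⊥ n‖²` the signal part gives `‖g‖² (J - 1) v`, the term linear in `b` averages to
0, and the noise part gives `(J - 1) v²`. -/
lemma integral_norm_sq_orthPart_excess {g : CVec J} (hg : g ≠ 0) {v : ℝ} (hv : 0 ≤ v) :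
    ∫ x, ‖orthPart (direction g) (Matrix.toEuclideanLin (excess g v x) (direction g))‖ ^ 2
        ∂(bpsk.prod (awgn J v))
      = ((J : ℝ) - 1) * ((v * ‖g‖ ^ 2 + v ^ 2) / ‖g‖ ^ 4) := by
  have hh := norm_direction hg
  have hg0 : 0 < ‖g‖ := norm_pos_iff.mpr hg
  set h := direction g with hdef
  have hc := continuous_orthPart h
  obtain ⟨m1, m2⟩ := integral_norm_sq_orthPart_awgn (v := v) hv hh
  have hin : ∀ n : CVec J, ‖inner ℂ h n‖ ≤ ‖n‖ := fun n =>
    (norm_inner_le_norm _ _).trans (by rw [hh, one_mul])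
  have i1 : Integrable (fun n : CVec J => ‖orthPart h n‖ ^ 2) (awgn J v) := by
    refine (integrable_norm_pow_awgn hv 2).mono' (by fun_prop) (ae_of_all _ fun n => ?_)
    simp only [norm_pow, norm_norm]
    gcongr
    exact norm_orthPart_le hh n
  have i2 : Integrable (fun n : CVec J => ‖orthPart h n‖ ^ 2 * ‖inner ℂ h n‖ ^ 2) (awgn J v) := by
    refine (integrable_norm_pow_awgn hv 4).mono' (by fun_prop) (ae_of_all _ fun n => ?_)
    rw [show ‖n‖ ^ 4 = ‖n‖ ^ 2 * ‖n‖ ^ 2 by ring]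
    simp only [norm_pow, norm_norm, norm_mul]
    gcongr
    · exact norm_orthPart_le hh n
    · exact hin n
  have i3 : Integrable (fun n : CVec J => (inner ℂ h n).re * ‖orthPart h n‖ ^ 2) (awgn J v) := by
    refine (integrable_norm_pow_awgn hv 3).mono' ?_ (ae_of_all _ fun n => ?_)
    · exact ((Complex.continuous_re.comp (by fun_prop : Continuous fun n => inner ℂ h n)).mul
        (hc.norm.pow 2)).aestronglyMeasurable
    · rw [show ‖n‖ ^ 3 = ‖n‖ * ‖n‖ ^ 2 by ring]
      rw [norm_mul, norm_pow, norm_norm, Real.norm_eq_abs]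
      gcongr
      · exact (Complex.abs_re_le_norm _).trans (hin n)
      · exact norm_orthPart_le hh n
  have h1 : ∫ x, ‖orthPart h (Matrix.toEuclideanLin (excess g v x) h)‖ ^ 2
        ∂(bpsk.prod (awgn J v)) = ∫ x : ℝ × CVec J, ((‖g‖ ^ 2)⁻¹) ^ 2 *
        (‖g‖ ^ 2 * ‖orthPart h x.2‖ ^ 2
        + x.1 * (2 * ‖g‖ * ((inner ℂ h x.2).re * ‖orthPart h x.2‖ ^ 2))
        + ‖orthPart h x.2‖ ^ 2 * ‖inner ℂ h x.2‖ ^ 2) ∂(bpsk.prod (awgn J v)) := by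
    refine integral_congr_ae ?_
    filter_upwards [ae_sq_fst_eq_one (awgn J v)] with x hx
    exact norm_sq_orthPart_excess hg v hx
  have j1 := (i1.comp_snd bpsk).const_mul (‖g‖ ^ 2)
  have j2 := integrable_id_bpsk.mul_prod (i3.const_mul (2 * ‖g‖))
  have j3 := i2.comp_snd bpsk
  rw [h1, integral_const_mul, integral_add (j1.fun_add j2) j3, integral_add j1 j2,
    integral_const_mul, integral_fun_snd (f := fun n : CVec J => ‖orthPart h n‖ ^ 2),
    integral_fun_snd (f := fun n : CVec J => ‖orthPart h n‖ ^ 2 * ‖inner ℂ h n‖ ^ 2),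
    integral_prod_mul (fun b : ℝ => b)
      (fun n : CVec J => 2 * ‖g‖ * ((inner ℂ h n).re * ‖orthPart h n‖ ^ 2)),
    integral_id_bpsk, m1, m2]
  simp only [probReal_univ, one_smul, zero_mul, add_zero]
  field_simp

end SampleMoments

/-! ### From pathwise perturbation to mean-square bounds -/

section MeanSquareError

variable {Ω : Type*} [MeasurableSpace Ω] {P : Measure Ω} [IsProbabilityMeasure P]

/-- Below the cutoff `τ` the first-order estimate applies; above it, both 1 and `S²` are at most `S⁴
/ τ⁴`. -/
lemma abs_sub_le_of_small_perturbation {Q W S τ : ℝ} (hτ0 : 0 < τ) (hτ : τ ≤ 1 / 4) (hQ0 : 0 ≤ Q)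
    (hQ1 : Q ≤ 1) (hW0 : 0 ≤ W) (hWS : W ≤ S ^ 2) (hS : S ≤ 1 / 4 → |Q - W| ≤ 16 * S * W) :
    |Q - W| ≤ 16 * τ * W + S ^ 4 / τ ^ 4 := by
  by_cases h : S ≤ τ
  · have h1 := hS (h.trans hτ)
    have h2 : S * W ≤ τ * W := by gcongr
    have h3 : 0 ≤ S ^ 4 / τ ^ 4 := by positivity
    linarith
  · push Not at h
    have hS0 : 0 < S := hτ0.trans h
    have hτ4 : 0 < τ ^ 4 := by positivity
    have h1 : 1 ≤ S ^ 4 / τ ^ 4 := by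
      rw [one_le_div hτ4]; gcongr
    have h2 : S ^ 2 ≤ S ^ 4 / τ ^ 4 := by
      rw [le_div_iff₀ hτ4]
      have h3 : τ ^ 4 ≤ S ^ 2 := by
        calc τ ^ 4 ≤ τ ^ 2 := pow_le_pow_of_le_one hτ0.le (by linarith) (by norm_num)
          _ ≤ S ^ 2 := by gcongr
      calc S ^ 2 * τ ^ 4 ≤ S ^ 2 * S ^ 2 := by gcongr
        _ = S ^ 4 := by ring
    have h3 : 0 ≤ 16 * τ * W := by positivity
    rw [abs_le]
    constructor <;> linarith

/-- For `S ≤ 1/4`, `Q ≤ 5W ≤ 5S²`; otherwise `Q² ≤ 1 ≤ 4⁴ S⁴`, which is where 256 comes from. -/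
lemma sq_le_of_small_perturbation {Q W S : ℝ} (hQ0 : 0 ≤ Q)
    (hQ1 : Q ≤ 1) (hW0 : 0 ≤ W) (hWS : W ≤ S ^ 2)
    (hS : S ≤ 1 / 4 → |Q - W| ≤ 16 * S * W) : Q ^ 2 ≤ 256 * S ^ 4 := by
  by_cases h : S ≤ 1 / 4
  · have h1 := (abs_le.mp (hS h)).2
    have h2 : S * W ≤ 1 / 4 * W := by gcongr
    have h3 : Q ≤ 5 * S ^ 2 := by linarith
    have h4 : Q ^ 2 ≤ (5 * S ^ 2) ^ 2 := by gcongr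
    have h5 : 0 ≤ S ^ 4 := by positivity
    linarith [show (5 * S ^ 2) ^ 2 = 25 * S ^ 4 by ring]
  · push Not at h
    have h1 : (1 / 4 : ℝ) ^ 4 ≤ S ^ 4 := by gcongr
    nlinarith

/-- Mean-square bounds for an error with orthogonal part `Q`, parallel part `a ^ 2` and total `D`,
when `Q` is compared with its first-order approximation `W`. -/
lemma mean_square_error_bounds {Q W S a D : Ω → ℝ} {ε F C : ℝ} (hε : 0 < ε) (hF0 : 0 ≤ F)
    (hFε : F ≤ ε ^ 2 / 2)
    (hFC : C * F ≤ min ε 1 / 4 * (min ε 1 / 4 / 32) ^ 4 / 512)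
    (hQm : AEMeasurable Q P) (ham : AEMeasurable a P)
    (hQ : ∀ᵐ ω ∂P, 0 ≤ Q ω ∧ Q ω ≤ 1) (ha : ∀ᵐ ω ∂P, 0 ≤ a ω ∧ a ω ≤ Q ω)
    (hD : ∀ᵐ ω ∂P, D ω = Q ω + a ω ^ 2) (hW : ∀ᵐ ω ∂P, 0 ≤ W ω ∧ W ω ≤ S ω ^ 2)
    (hS : ∀ᵐ ω ∂P, S ω ≤ 1 / 4 → |Q ω - W ω| ≤ 16 * S ω * W ω)
    (hWi : Integrable W P) (hWF : ∫ ω, W ω ∂P = F)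
    (hSi : Integrable (fun ω => S ω ^ 4) P) (hSC : ∫ ω, S ω ^ 4 ∂P ≤ C * F ^ 2) :
    P {ω | ε * Q ω < a ω ^ 2} ≤ ENNReal.ofReal ε ∧
      ∫ ω, a ω ^ 2 ∂P ≤ ε * ∫ ω, Q ω ∂P ∧
      |∫ ω, D ω ∂P - ∫ ω, Q ω ∂P| ≤ ε * ∫ ω, Q ω ∂P ∧
      |∫ ω, Q ω ∂P - F| ≤ ε * F ∧ |∫ ω, D ω ∂P - F| ≤ ε * F := by
  -- Both `|𝔼 Q - F|` and `𝔼 a²` will be at most `e F`. The cap at 1 gives `𝔼 Q ≥ F / 2`, which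
  -- turns bounds in `F` into bounds in `𝔼 Q`.
  set e := min ε 1 / 4 with he
  have he0 : 0 < e := by positivity
  have he1 : e ≤ 1 / 4 := by rw [he]; linarith [min_le_right ε 1]
  have heε : 4 * e ≤ ε := by rw [he]; linarith [min_le_left ε 1]
  -- Then `16 τ = e / 2`; the other half of the budget pays for the fourth moment.
  set τ := e / 32 with hτ
  have hτ0 : 0 < τ := by positivity
  have hτ1 : τ ≤ 1 / 4 := by rw [hτ]; linarith
  have hQi : Integrable Q P := by
    refine (integrable_const (1 : ℝ)).mono' hQm.aestronglyMeasurable ?_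
    filter_upwards [hQ] with ω h
    rw [Real.norm_eq_abs, abs_of_nonneg h.1]; exact h.2
  have hai : Integrable (fun ω => a ω ^ 2) P := by
    refine (integrable_const (1 : ℝ)).mono' (ham.pow_const 2).aestronglyMeasurable ?_
    filter_upwards [hQ, ha] with ω h h'
    rw [norm_pow, Real.norm_eq_abs, sq_abs]
    nlinarith
  have hτ4 : 0 < τ ^ 4 := by positivity
  have hτ41 : τ ^ 4 ≤ 1 := pow_le_one₀ hτ0.le (by linarith)
  have hQF : |∫ ω, Q ω ∂P - F| ≤ e * F := by
    rw [← hWF, ← integral_sub hQi hWi, hWF]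
    calc |∫ ω, Q ω - W ω ∂P| ≤ ∫ ω, |Q ω - W ω| ∂P := abs_integral_le_integral_abs
      _ ≤ ∫ ω, (16 * τ * W ω + S ω ^ 4 / τ ^ 4) ∂P := by
        refine integral_mono_ae (hQi.sub' hWi).abs
          ((hWi.const_mul _).fun_add (hSi.div_const _)) ?_
        filter_upwards [hQ, hW, hS] with ω h1 h2 h3
        exact abs_sub_le_of_small_perturbation hτ0 hτ1 h1.1 h1.2 h2.1 h2.2 h3
      _ = 16 * τ * F + (∫ ω, S ω ^ 4 ∂P) / τ ^ 4 := by
        rw [integral_add (hWi.const_mul _) (hSi.div_const _), integral_const_mul, hWF,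
          integral_div]
      _ ≤ 16 * τ * F + (e / 2) * F := by
        gcongr
        rw [div_le_iff₀ hτ4]
        refine hSC.trans ?_
        calc C * F ^ 2 = (C * F) * F := by ring
          _ ≤ (e * τ ^ 4 / 512) * F := by gcongr
          _ ≤ e / 2 * F * τ ^ 4 := by
            have : 0 ≤ e * τ ^ 4 * F := by positivity
            linarith
      _ = e * F := by rw [hτ]; ring
  have haF : ∫ ω, a ω ^ 2 ∂P ≤ e * F := by
    calc ∫ ω, a ω ^ 2 ∂P ≤ ∫ ω, 256 * S ω ^ 4 ∂P := by
          refine integral_mono_ae hai (hSi.const_mul _) ?_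
          filter_upwards [hQ, ha, hW, hS] with ω h1 h2 h3 h4
          refine le_trans ?_ (sq_le_of_small_perturbation h1.1 h1.2 h3.1 h3.2 h4)
          exact pow_le_pow_left₀ h2.1 h2.2 2
      _ = 256 * ∫ ω, S ω ^ 4 ∂P := integral_const_mul _ _
      _ ≤ 256 * (C * F ^ 2) := by gcongr
      _ = 256 * ((C * F) * F) := by ring
      _ ≤ 256 * ((e * τ ^ 4 / 512) * F) := by gcongr
      _ = e * F * τ ^ 4 / 2 := by ring
      _ ≤ e * F := by
        have h1 : 0 ≤ e * F := by positivity
        have h2 : e * F * τ ^ 4 ≤ e * F := mul_le_of_le_one_right h1 hτ41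
        linarith
  have ha0 : 0 ≤ ∫ ω, a ω ^ 2 ∂P := integral_nonneg fun ω => sq_nonneg _
  have hDi : ∫ ω, D ω ∂P = ∫ ω, Q ω ∂P + ∫ ω, a ω ^ 2 ∂P := by
    rw [← integral_add hQi hai]
    exact integral_congr_ae hD
  obtain ⟨hl, hu⟩ := abs_le.mp hQF
  have heF : e * F ≤ 1 / 4 * F := by gcongr
  have hεF : 4 * e * F ≤ ε * F := by gcongr
  have heF0 : 0 ≤ e * F := by positivity
  have hQlow : F ≤ 2 * ∫ ω, Q ω ∂P := by linarith
  have hkey : ∫ ω, a ω ^ 2 ∂P ≤ ε * ∫ ω, Q ω ∂P := by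
    have : ε * F ≤ ε * (2 * ∫ ω, Q ω ∂P) := by gcongr
    linarith
  refine ⟨?_, hkey, ?_, ?_, ?_⟩
  -- As `a² ≤ Q²`, the bad event forces `Q ≥ ε`, and Markov with `𝔼 Q ≤ 2F ≤ ε²` gives probability
  -- at most `ε`.
  · have hmk := mul_meas_ge_le_integral_of_nonneg (hQ.mono fun ω h => h.1) hQi ε
    have hle : P {ω | ε * Q ω < a ω ^ 2} ≤ P {ω | ε ≤ Q ω} := by
      refine measure_mono_ae ?_
      filter_upwards [hQ, ha] with ω h1 h2 h3
      have h3' : ε * Q ω < a ω ^ 2 := h3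
      have h4 : a ω ^ 2 ≤ Q ω ^ 2 := pow_le_pow_left₀ h2.1 h2.2 2
      change ε ≤ Q ω
      by_contra hlt
      push Not at hlt
      nlinarith
    refine hle.trans ?_
    rw [← ofReal_measureReal]
    refine ENNReal.ofReal_le_ofReal ?_
    have h5 : ε * P.real {ω | ε ≤ Q ω} ≤ ε * ε := by nlinarith
    exact le_of_mul_le_mul_left h5 hε
  · rw [hDi, add_sub_cancel_left, abs_of_nonneg ha0]
    exact hkey
  · exact hQF.trans (by linarith)
  · rw [hDi, abs_le]
    constructor <;> linarith

end MeanSquareError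

/-! ### The sample covariance as a perturbed rank-one projection -/

section SampleCovariance

variable {J N : ℕ}

/-- The average over the samples of the relative deviations `excess`. -/
noncomputable def meanExcess (g : CVec J) (v : ℝ) (x : Fin N → ℝ × CVec J) :
    Matrix (Fin J) (Fin J) ℂ :=
  (N : ℂ)⁻¹ • ∑ i, excess g v (x i)

lemma map_meanExcess (g : CVec J) (v : ℝ) (x : Fin N → ℝ × CVec J)
    (L : Matrix (Fin J) (Fin J) ℂ →ₗ[ℂ] ℂ) :
    L (meanExcess g v x) = (N : ℂ)⁻¹ * ∑ i, L (excess g v (x i)) := by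
  rw [meanExcess, map_smul, map_sum, smul_eq_mul]

lemma isHermitian_sampleCov (r : Fin N → CVec J) : (sampleCov r).IsHermitian := by
  ext k l
  simp only [sampleCov, Matrix.conjTranspose_apply, Matrix.smul_apply, Matrix.sum_apply,
    Matrix.of_apply, smul_eq_mul, star_mul', star_sum, star_star, star_inv₀, star_natCast]
  congr 1
  exact Finset.sum_congr rfl fun i _ => mul_comm _ _

lemma toEuclideanLin_sampleCov_apply (hN : 0 < N) {g : CVec J} (hg : g ≠ 0) (v : ℝ)
    (x : Fin N → ℝ × CVec J) (y : CVec J) :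
    Matrix.toEuclideanLin (sampleCov fun i => received g (x i).1 (x i).2) y
      = ((‖g‖ ^ 2 : ℝ) : ℂ) • (alongCoeff (direction g) y • direction g
        + Matrix.toEuclideanLin (meanExcess g v x) y) + (v : ℂ) • y := by
  have hNc : (N : ℂ) ≠ 0 := by exact_mod_cast hN.ne'
  have hgc : (‖g‖ : ℂ) ≠ 0 := by exact_mod_cast norm_ne_zero_iff.mpr hg
  have h1 : ((‖g‖ ^ 2 : ℝ) : ℂ) • (alongCoeff (direction g) y • direction g) = inner ℂ g y • g := by
    rw [alongCoeff, direction, inner_smul_left, smul_smul, smul_smul]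
    congr 1
    simp only [map_inv₀, Complex.conj_ofReal]
    push_cast
    field_simp
  have h2 : Matrix.toEuclideanLin (meanExcess g v x) y
      = (N : ℂ)⁻¹ • ∑ i, Matrix.toEuclideanLin (excess g v (x i)) y := by
    simp only [meanExcess, map_smul, map_sum, LinearMap.smul_apply, LinearMap.sum_apply]
  have h3 : Matrix.toEuclideanLin (sampleCov fun i => received g (x i).1 (x i).2) y
      = (N : ℂ)⁻¹ • ∑ i, inner ℂ (received g (x i).1 (x i).2) y • received g (x i).1 (x i).2 := by
    simp only [sampleCov, map_smul, map_sum, LinearMap.smul_apply, LinearMap.sum_apply]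
    congr 1
    refine Finset.sum_congr rfl fun i _ => ?_
    ext k
    simp only [Matrix.toLpLin_apply, Matrix.mulVec, dotProduct, Matrix.of_apply, PiLp.smul_apply,
      smul_eq_mul, PiLp.inner_apply, RCLike.inner_apply, Finset.sum_mul]
    exact Finset.sum_congr rfl fun l _ => by rw [Complex.star_def]; ring
  have h4 : ((‖g‖ ^ 2 : ℝ) : ℂ) ≠ 0 := by push_cast; exact pow_ne_zero 2 hgc
  rw [smul_add, h1, h2, h3]
  simp only [toEuclideanLin_excess_apply]
  rw [← Finset.smul_sum, smul_comm (N : ℂ)⁻¹, smul_smul, mul_inv_cancel₀ h4, one_smul,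
    Finset.sum_sub_distrib, Finset.sum_sub_distrib, smul_sub, smul_sub]
  simp only [Finset.sum_const, Finset.card_univ, Fintype.card_fin, ← Nat.cast_smul_eq_nsmul ℂ]
  rw [inv_smul_smul₀ hNc, inv_smul_smul₀ hNc]
  abel

lemma abs_sub_le_of_isTopEigenvector (hN : 0 < N) {g : CVec J} (hg : g ≠ 0) (v : ℝ)
    (x : Fin N → ℝ × CVec J) {u : CVec J}
    (hu : IsTopEigenvector (sampleCov fun i => received g (x i).1 (x i).2) u)
    (hS : ∑ k, ∑ l, ‖meanExcess g v x k l‖ ≤ 1 / 4) :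
    |‖orthPart (direction g) u‖ ^ 2
        - ‖orthPart (direction g) (Matrix.toEuclideanLin (meanExcess g v x) (direction g))‖ ^ 2|
      ≤ 16 * (∑ k, ∑ l, ‖meanExcess g v x k l‖)
        * ‖orthPart (direction g) (Matrix.toEuclideanLin (meanExcess g v x) (direction g))‖ ^ 2 := by
  obtain ⟨hu1, lam, hlam, hmax⟩ := hu
  have hh := norm_direction hg
  have hG : 0 < ‖g‖ ^ 2 := by have := norm_pos_iff.mpr hg; positivity
  have hGc : ((‖g‖ ^ 2 : ℝ) : ℂ) ≠ 0 := by exact_mod_cast hG.ne'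
  -- Undoing the shift by `v` and the scaling by `‖g‖²` gives the eigenvalue for `h hᴴ + E`.
  refine abs_norm_sq_orthPart_eigenvector_sub_le hh hu1 _ (l := (lam - v) / ‖g‖ ^ 2)
    (Finset.sum_nonneg fun k _ => Finset.sum_nonneg fun l _ => norm_nonneg _) hS
    (norm_toEuclideanLin_le _) ?_ ?_
  · have h1 := hlam.apply_eq_smul
    rw [toEuclideanLin_sampleCov_apply hN hg v] at h1
    have h2 := eq_sub_of_add_eq h1
    rw [← sub_smul] at h2
    refine smul_right_injective _ hGc ?_
    dsimp only
    rw [h2, smul_smul, ← Complex.ofReal_mul, mul_div_cancel₀ _ hG.ne', Complex.ofReal_sub]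
  · have h1 := re_inner_le_of_isTopEigenvalue (isHermitian_sampleCov _) hmax (direction g)
    rw [toEuclideanLin_sampleCov_apply hN hg v, inner_add_right, inner_smul_right, inner_add_right,
      inner_smul_right, inner_smul_right, alongCoeff, inner_self_eq_norm_sq_to_K, hh] at h1
    rw [le_div_iff₀ hG]
    simp only [Complex.add_re, Complex.re_ofReal_mul] at h1
    norm_num at h1
    linarith

lemma norm_sq_orthPart_toEuclideanLin_le {h : CVec J} (hh : ‖h‖ = 1)
    (A : Matrix (Fin J) (Fin J) ℂ) :
    ‖orthPart h (Matrix.toEuclideanLin A h)‖ ^ 2 ≤ (∑ k, ∑ l, ‖A k l‖) ^ 2 := by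
  gcongr
  have := norm_toEuclideanLin_le A h
  rw [hh, mul_one] at this
  exact (norm_orthPart_le hh _).trans this

/-- The `k`-th coordinate of the part of `A h` orthogonal to `h`, as a function of `A`. -/
noncomputable def orthCoord (h : CVec J) (k : Fin J) : Matrix (Fin J) (Fin J) ℂ →ₗ[ℂ] ℂ where
  toFun A := orthPart h (Matrix.toEuclideanLin A h) k
  map_add' A B := by
    rw [map_add, LinearMap.add_apply, orthPart_add, PiLp.add_apply]
  map_smul' c A := by
    rw [map_smul, LinearMap.smul_apply, orthPart_smul, PiLp.smul_apply]; rfl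

lemma norm_sq_orthPart_eq_sum_orthCoord (h : CVec J) (A : Matrix (Fin J) (Fin J) ℂ) :
    ‖orthPart h (Matrix.toEuclideanLin A h)‖ ^ 2 = ∑ k, ‖orthCoord h k A‖ ^ 2 :=
  EuclideanSpace.norm_sq_eq _

variable {Ω : Type*} [MeasurableSpace Ω] {P : Measure Ω} [IsProbabilityMeasure P]

lemma IsTransmission.hasLaw {σ : ℝ} {b : Fin N → Ω → ℝ} {n : Fin N → Ω → CVec J}
    (ht : IsTransmission P σ b n) (i : Fin N) :
    HasLaw (fun ω => (b i ω, n i ω)) (bpsk.prod (awgn J (σ ^ 2))) P where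
  aemeasurable := (ht.law_symbol i).aemeasurable.prodMk (ht.law_noise i).aemeasurable
  map_eq := by
    rw [(indepFun_iff_map_prod_eq_prod_map_map (ht.law_symbol i).aemeasurable
      (ht.law_noise i).aemeasurable).mp (ht.indep_symbol_noise i), (ht.law_symbol i).map_eq,
      (ht.law_noise i).map_eq]

/-- The mean of the first-order approximation of the squared error is exactly `mseFormula`. -/
lemma IsTransmission.integral_norm_sq_orthPart_meanExcess (hN : 0 < N) {g : CVec J} (hg : g ≠ 0)
    {σ : ℝ} {b : Fin N → Ω → ℝ} {n : Fin N → Ω → CVec J} (ht : IsTransmission P σ b n) :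
    Integrable (fun ω => ‖orthPart (direction g) (Matrix.toEuclideanLin
        (meanExcess g (σ ^ 2) fun i => (b i ω, n i ω)) (direction g))‖ ^ 2) P ∧
      ∫ ω, ‖orthPart (direction g) (Matrix.toEuclideanLin
        (meanExcess g (σ ^ 2) fun i => (b i ω, n i ω)) (direction g))‖ ^ 2 ∂P
        = mseFormula g σ N := by
  have hv := sq_nonneg σ
  have key := fun k => integral_average_norm_pow hN ht.hasLaw ht.indep_samples
    (linearMap_excess g hv (orthCoord (direction g) k)).1
    (linearMap_excess g hv (orthCoord (direction g) k)).2.1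
    (linearMap_excess g hv (orthCoord (direction g) k)).2.2
  have hint : ∀ k, Integrable (fun ω => ‖orthCoord (direction g) k
      (meanExcess g (σ ^ 2) fun i => (b i ω, n i ω))‖ ^ 2) P := fun k => by
    simp only [map_meanExcess]
    exact integrable_pow_of_memLp_four (key k).1.norm (show 2 ≤ 4 by norm_num)
  have hint' : ∀ k, Integrable (fun x => ‖orthCoord (direction g) k (excess g (σ ^ 2) x)‖ ^ 2)
      (bpsk.prod (awgn J (σ ^ 2))) := fun k =>
    integrable_pow_of_memLp_four (linearMap_excess g hv (orthCoord (direction g) k)).2.1.norm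
      (show 2 ≤ 4 by norm_num)
  have hmain := integral_norm_sq_orthPart_excess hg hv
  simp only [norm_sq_orthPart_eq_sum_orthCoord] at hmain ⊢
  refine ⟨integrable_finsetSum _ fun k _ => hint k, ?_⟩
  rw [integral_finsetSum _ fun k _ => hint' k] at hmain
  rw [integral_finsetSum _ fun k _ => hint k]
  simp only [map_meanExcess, (key _).2.1]
  rw [← Finset.mul_sum, hmain, mseFormula]
  have : ‖g‖ ≠ 0 := norm_ne_zero_iff.mpr hg
  field_simp

lemma IsTransmission.integral_sum_norm_meanExcess_pow_four_le (hN : 0 < N) {g : CVec J}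
    {σ : ℝ} {b : Fin N → Ω → ℝ} {n : Fin N → Ω → CVec J} (ht : IsTransmission P σ b n) {M : ℝ}
    (hM : ∀ k l : Fin J, ∫ x, ‖excess g (σ ^ 2) x k l‖ ^ 4 ∂(bpsk.prod (awgn J (σ ^ 2))) ≤ M) :
    Integrable (fun ω =>
        (∑ k, ∑ l, ‖meanExcess g (σ ^ 2) (fun i => (b i ω, n i ω)) k l‖) ^ 4) P ∧
      ∫ ω, (∑ k, ∑ l, ‖meanExcess g (σ ^ 2) (fun i => (b i ω, n i ω)) k l‖) ^ 4 ∂P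
        ≤ 12 * (J : ℝ) ^ 8 * ((N : ℝ)⁻¹) ^ 2 * M := by
  have hv := sq_nonneg σ
  have hentry : ∀ x : Fin N → ℝ × CVec J, ∀ k l, meanExcess g (σ ^ 2) x k l
      = (N : ℂ)⁻¹ * ∑ i, excess g (σ ^ 2) (x i) k l := fun x k l => by
    simp [meanExcess, Matrix.sum_apply]
  have key := fun k l => integral_average_norm_pow hN ht.hasLaw ht.indep_samples
    (measurable_excess g (σ ^ 2) k l) (memLp_excess g hv k l) (integral_excess g hv k l)
  simp only [hentry]
  set E : Fin J → Fin J → Ω → ℂ := fun k l ω =>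
    (N : ℂ)⁻¹ * ∑ i, excess g (σ ^ 2) (b i ω, n i ω) k l with hE
  have hEi : ∀ k l, Integrable (fun ω => ‖E k l ω‖ ^ 4) P := fun k l =>
    integrable_pow_of_memLp_four (key k l).1.norm le_rfl
  have hm : MemLp (fun ω => ∑ k, ∑ l, ‖E k l ω‖) 4 P :=
    memLp_finsetSum _ fun k _ => memLp_finsetSum _ fun l _ => (key k l).1.norm
  refine ⟨integrable_pow_of_memLp_four hm le_rfl, ?_⟩
  -- Power mean over `J²` entries, whence `(J²)³`; summing the `J²` moments then gives `J⁸`.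
  have hpow : ∀ ω, (∑ k, ∑ l, ‖E k l ω‖) ^ 4 ≤ (J : ℝ) ^ 6 * ∑ k, ∑ l, ‖E k l ω‖ ^ 4 := fun ω => by
    have h1 := pow_sum_le_card_mul_sum_pow (s := (Finset.univ : Finset (Fin J × Fin J)))
      (f := fun p => ‖E p.1 p.2 ω‖) (fun p _ => norm_nonneg _) 3
    rw [Fintype.sum_prod_type, Fintype.sum_prod_type] at h1
    refine h1.trans (le_of_eq ?_)
    simp only [Finset.card_univ, Fintype.card_prod, Fintype.card_fin]
    push_cast
    ring
  calc ∫ ω, (∑ k, ∑ l, ‖E k l ω‖) ^ 4 ∂P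
      ≤ ∫ ω, (J : ℝ) ^ 6 * ∑ k, ∑ l, ‖E k l ω‖ ^ 4 ∂P :=
        integral_mono (integrable_pow_of_memLp_four hm le_rfl)
          ((integrable_finsetSum _ fun k _ => integrable_finsetSum _ fun l _ => hEi k l).const_mul _)
          hpow
    _ = (J : ℝ) ^ 6 * ∑ k, ∑ l, ∫ ω, ‖E k l ω‖ ^ 4 ∂P := by
        rw [integral_const_mul,
          integral_finsetSum _ fun k _ => integrable_finsetSum _ fun l _ => hEi k l]
        congr 1
        exact Finset.sum_congr rfl fun k _ => integral_finsetSum _ fun l _ => hEi k l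
    _ ≤ (J : ℝ) ^ 6 * ∑ _k : Fin J, ∑ _l : Fin J, 12 * ((N : ℝ)⁻¹) ^ 2 * M := by
        gcongr with k _ l _
        exact (key k l).2.2.trans (by gcongr; exact hM k l)
    _ = _ := by
        simp only [Finset.sum_const, Finset.card_univ, Fintype.card_fin, nsmul_eq_mul]
        ring

end SampleCovariance

lemma orthPart_eq_zero_of_one {h : CVec 1} (hh : ‖h‖ = 1) (x : CVec 1) : orthPart h x = 0 := by
  have h1 := norm_sq_eq_orthPart_add_alongCoeff hh x
  have h2 : ‖alongCoeff h x‖ = ‖h‖ * ‖x‖ := by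
    simp [alongCoeff, PiLp.inner_apply, EuclideanSpace.norm_eq, mul_comm]
  rw [h2, hh, one_mul] at h1
  have : ‖orthPart h x‖ ^ 2 = 0 := by linarith
  simpa using this

/-- The factor `J - 1` is at least 1, so the fourth-moment bound becomes `C F²`. For `J = 1` this
fails, since `F = 0`. -/
lemma le_mseFormula {J : ℕ} (hJ : 2 ≤ J) (g : CVec J) (σ : ℝ) (N : ℕ) :
    (N : ℝ)⁻¹ * ((σ ^ 2 * ‖g‖ ^ 2 + (σ ^ 2) ^ 2) / ‖g‖ ^ 4) ≤ mseFormula g σ N := by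
  have hJ' : (2 : ℝ) ≤ J := by exact_mod_cast hJ
  have h0 : 0 ≤ (N : ℝ)⁻¹ * ((σ ^ 2 * ‖g‖ ^ 2 + (σ ^ 2) ^ 2) / ‖g‖ ^ 4) := by positivity
  have h1 : mseFormula g σ N
      = (N : ℝ)⁻¹ * ((σ ^ 2 * ‖g‖ ^ 2 + (σ ^ 2) ^ 2) / ‖g‖ ^ 4) * ((J : ℝ) - 1) := by
    rw [mseFormula, div_eq_mul_inv, mul_inv, div_eq_mul_inv]; ring
  rw [h1]
  exact le_mul_of_one_le_right h0 (by linarith)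

end SIMO

/-! ### Choice of the threshold and assembly -/

theorem theorem1 (J : ℕ) (ε : ℝ) (hε : 0 < ε) :
    ∃ η : ℝ, 0 < η ∧
      ∀ (Ω : Type*) [MeasurableSpace Ω] (P : Measure Ω) [IsProbabilityMeasure P]
        (N : ℕ) (_ : 0 < N) (g : SIMO.CVec J) (_ : g ≠ 0) (σ : ℝ) (_ : 0 < σ)
        (b : Fin N → Ω → ℝ) (n : Fin N → Ω → SIMO.CVec J)
        (_ : SIMO.IsTransmission P σ b n)
        (u : Ω → SIMO.CVec J) (_ : AEMeasurable u P)
        (_ : ∀ᵐ ω ∂P, SIMO.IsTopEigenvector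
          (SIMO.sampleCov (fun i => SIMO.received g (b i ω) (n i ω))) (u ω))
        (θ : Ω → ℝ) (_ : AEMeasurable θ P)
        (_ : ∀ᵐ ω ∂P, SIMO.IsOptimalPhase (SIMO.direction g) (u ω) (θ ω))
        (δh : Ω → SIMO.CVec J)
        (_ : ∀ ω, δh ω = SIMO.rotate (θ ω) (u ω) - SIMO.direction g)
        (α : Ω → ℂ) (_ : ∀ ω, α ω = SIMO.alongCoeff (SIMO.direction g) (δh ω))
        (q : Ω → SIMO.CVec J) (_ : ∀ ω, q ω = SIMO.orthPart (SIMO.direction g) (δh ω)),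
        -- the component along `h` is negligible, realization by realization
        (∀ᵐ ω ∂P, ‖q ω‖ ≤ η → ‖α ω‖ ^ 2 ≤ ε * ‖q ω‖ ^ 2) ∧
        (SIMO.mseFormula g σ N ≤ η →
          -- it is negligible with high probability and in mean square
          P {ω | ε * ‖q ω‖ ^ 2 < ‖α ω‖ ^ 2} ≤ ENNReal.ofReal ε ∧
          ∫ ω, ‖α ω‖ ^ 2 ∂P ≤ ε * ∫ ω, ‖q ω‖ ^ 2 ∂P ∧
          -- the mean-squared error
          |∫ ω, ‖δh ω‖ ^ 2 ∂P - ∫ ω, ‖q ω‖ ^ 2 ∂P| ≤ ε * ∫ ω, ‖q ω‖ ^ 2 ∂P ∧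
          |∫ ω, ‖q ω‖ ^ 2 ∂P - SIMO.mseFormula g σ N| ≤ ε * SIMO.mseFormula g σ N ∧
          |∫ ω, ‖δh ω‖ ^ 2 ∂P - SIMO.mseFormula g σ N| ≤ ε * SIMO.mseFormula g σ N) := by
  obtain ⟨C₀, hC₀, hmom⟩ := SIMO.exists_integral_norm_excess_pow_four_le J
  set C : ℝ := 12 * (J : ℝ) ^ 8 * C₀ with hC
  have hC0 : 0 ≤ C := by positivity
  set e : ℝ := min ε 1 / 4 * (min ε 1 / 4 / 32) ^ 4 / 512 with he
  have he0 : 0 < e := by positivity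
  -- The bounds `ε` and 1 serve (i), `ε² / 2` serves Markov's inequality, and the last gives `C F ≤
  -- e`; `C + 1` avoids dividing by 0.
  refine ⟨min (min ε 1) (min (ε ^ 2 / 2) (e / (C + 1))), by positivity, ?_⟩
  set η : ℝ := min (min ε 1) (min (ε ^ 2 / 2) (e / (C + 1))) with hη
  have hη1 : η ≤ ε := (min_le_left _ _).trans (min_le_left _ _)
  have hη2 : η ≤ 1 := (min_le_left _ _).trans (min_le_right _ _)
  have hη3 : η ≤ ε ^ 2 / 2 := (min_le_right _ _).trans (min_le_left _ _)
  have hη4 : η ≤ e / (C + 1) := (min_le_right _ _).trans (min_le_right _ _)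
  intro Ω _ P _ N hN g hg σ hσ b n ht u hum hu θ hθm hθ δh hδ α hα q hq
  have hh := SIMO.norm_direction hg
  have hαm : ∀ᵐ ω ∂P, ‖α ω‖ ≤ ‖q ω‖ ^ 2 := by
    filter_upwards [hu, hθ] with ω h1 h2
    rw [hα, hq, hδ]
    exact SIMO.norm_alongCoeff_le_of_isOptimalPhase hh h1.1 h2
  have hqu : ∀ ω, ‖q ω‖ = ‖SIMO.orthPart (SIMO.direction g) (u ω)‖ := fun ω => by
    rw [hq, hδ, SIMO.norm_orthPart_rotate_sub hh]
  have hq1 : ∀ᵐ ω ∂P, 0 ≤ ‖q ω‖ ^ 2 ∧ ‖q ω‖ ^ 2 ≤ 1 := by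
    filter_upwards [hu] with ω h1
    refine ⟨sq_nonneg _, ?_⟩
    have h2 := SIMO.norm_orthPart_le hh (u ω)
    rw [h1.1, ← hqu] at h2
    exact pow_le_one₀ (norm_nonneg _) h2
  refine ⟨?_, fun hF => ?_⟩
  · filter_upwards [hαm] with ω h1 h2
    have h3 : ‖q ω‖ ^ 2 ≤ ε := by
      calc ‖q ω‖ ^ 2 ≤ η ^ 2 := pow_le_pow_left₀ (norm_nonneg _) h2 2
        _ ≤ η := by
          have : 0 ≤ η := (norm_nonneg _).trans h2
          nlinarith
        _ ≤ ε := hη1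
    calc ‖α ω‖ ^ 2 ≤ (‖q ω‖ ^ 2) ^ 2 := pow_le_pow_left₀ (norm_nonneg _) h1 2
      _ = ‖q ω‖ ^ 2 * ‖q ω‖ ^ 2 := sq _
      _ ≤ ε * ‖q ω‖ ^ 2 := by gcongr
  · have hJ0 : J ≠ 0 := by
      rintro rfl
      exact hg (Subsingleton.elim _ _)
    have hJ1 : (1 : ℝ) ≤ J := by exact_mod_cast Nat.one_le_iff_ne_zero.mpr hJ0
    have hF0 : 0 ≤ SIMO.mseFormula g σ N := by
      rw [SIMO.mseFormula]
      have : 0 ≤ (J : ℝ) - 1 := by linarith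
      positivity
    have hδm : AEMeasurable δh P := by
      rw [show δh = fun ω => SIMO.rotate (θ ω) (u ω) - SIMO.direction g from funext hδ]
      unfold SIMO.rotate
      fun_prop
    have hqm : AEMeasurable (fun ω => ‖q ω‖ ^ 2) P := by
      rw [show q = fun ω => SIMO.orthPart (SIMO.direction g) (δh ω) from funext hq]
      exact (((SIMO.continuous_orthPart _).measurable.comp_aemeasurable hδm).norm).pow_const 2
    have hαm' : AEMeasurable (fun ω => ‖α ω‖) P := by
      rw [show α = fun ω => SIMO.alongCoeff (SIMO.direction g) (δh ω) from funext hα]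
      unfold SIMO.alongCoeff
      exact (AEMeasurable.const_inner hδm).norm
    have hFC : C * SIMO.mseFormula g σ N ≤ e := by
      have h1 : SIMO.mseFormula g σ N * (C + 1) ≤ e :=
        (le_div_iff₀ (by positivity)).mp (hF.trans hη4)
      linarith
    have hD : ∀ᵐ ω ∂P, ‖δh ω‖ ^ 2 = ‖q ω‖ ^ 2 + ‖α ω‖ ^ 2 := ae_of_all _ fun ω => by
      rw [hq, hα]
      exact SIMO.norm_sq_eq_orthPart_add_alongCoeff hh _
    have hα0 : ∀ᵐ ω ∂P, 0 ≤ ‖α ω‖ ∧ ‖α ω‖ ≤ ‖q ω‖ ^ 2 :=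
      hαm.mono fun ω h => ⟨norm_nonneg _, h⟩
    rcases Nat.lt_or_ge J 2 with hJ2 | hJ2
    -- Here `F = 0` although the deviations need not vanish, so the general bound is applied with `W
    -- = S = 0`.
    · obtain rfl : J = 1 := by omega
      have hq0 : ∀ ω, ‖q ω‖ ^ 2 = 0 := fun ω => by
        rw [hqu, SIMO.orthPart_eq_zero_of_one hh, norm_zero, zero_pow two_ne_zero]
      have hFz : SIMO.mseFormula g σ N = 0 := by simp [SIMO.mseFormula]
      exact SIMO.mean_square_error_bounds (W := fun _ => 0) (S := fun _ => 0) hε hF0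
        (hF.trans hη3) hFC hqm hαm' hq1 hα0 hD (by simp) (by simp [hq0]) (by simp) (by simp [hFz])
        (by simp) (by simp [hFz])
    · obtain ⟨hWi, hWF⟩ := ht.integral_norm_sq_orthPart_meanExcess hN hg
      obtain ⟨hSi, hSC⟩ := ht.integral_sum_norm_meanExcess_pow_four_le hN
        (hmom g (σ ^ 2) hg (sq_nonneg σ))
      refine SIMO.mean_square_error_bounds hε hF0 (hF.trans hη3) hFC hqm hαm' hq1 hα0 hD
        (ae_of_all _ fun ω => ⟨sq_nonneg _, SIMO.norm_sq_orthPart_toEuclideanLin_le hh _⟩) ?_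
        hWi hWF hSi (hSC.trans ?_)
      · filter_upwards [hu] with ω h1 h2
        rw [hqu]
        exact SIMO.abs_sub_le_of_isTopEigenvector hN hg (σ ^ 2) (fun i => (b i ω, n i ω)) h1 h2
      · have h1 := pow_le_pow_left₀ (by positivity) (SIMO.le_mseFormula hJ2 g σ N) 2
        calc _ = C * ((N : ℝ)⁻¹ * ((σ ^ 2 * ‖g‖ ^ 2 + (σ ^ 2) ^ 2) / ‖g‖ ^ 4)) ^ 2 := by
              rw [hC]; ring
          _ ≤ _ := by gcongr
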